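/- **Notation.** For $F:\mathbb N\to\mathbb C$ let $F'(d)=\sum_{t\mid d}F(t)\mu(d/t)$, let $c_\ell(a)=\sum_{h\le \ell,\,(h,\ell)=1}\cos(2\pi ha/\ell)$ be the Ramanujan sum, and let $(P)$ be the set of positive integers all of whose prime factors are $\le P$. The Carmichael coefficient and the $P$-smooth Carmichael coefficient of $F$ are $$\mathrm{Car}_\ell F=\frac1{\varphi(\ell)}\lim_{x\to\infty}\frac1x\sum_{a\le x}F(a)c_\ell(a),\qquad \mathrm{Car}^{(P)}_\ell F=\frac1{\varphi(\ell)}\lim_{x\to\infty}\frac1x\sum_{a\le x}\Big(\sum_{d\in(P),\,d\mid a}F'(d)\Big)c_\ell(a),$$ which are said to exist if the limits exist. Write $e_q(j\bullet)$ for the function $a\mapsto e^{2\pi i ja/q}$, and $\tau(\chi)=\sum_{m \bmod n}\chi(m)e^{2\pi i m/n}$ for the Gauss sum of a Dirichlet character $\chi$ modulo $n$; $\chi_0$ is the principal character. **Theorem 5.** Let $q\ge1$, let $j$ be an integer coprime to $q$, and let $P$ be a prime with $P\ge q$. Then $\mathrm{Car}_\ell\, e_q(j\bullet)$ and $\mathrm{Car}^{(P)}_\ell\,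 e_q(j\bullet)$ exist for all $\ell\ge1$, and for every $\ell\in(P)$ $$\mathrm{Car}^{(P)}_\ell\, e_q(j\bullet)=\mathrm{Car}_\ell\, e_q(j\bullet)+\sum_{b\mid q}\frac1{b\,\varphi(q')}\sum_{\substack{\chi \bmod q'\\ \chi\ne\chi_0}}\tau(\overline\chi)\chi(j)\,\frac{\mu(q'')\chi(\ell'')}{\varphi(\ell')}\prod_{p\mid\ell''}\big(1-\overline\chi(p)\big)\,\frac{\prod_{p\le P}\big(1-\frac{\chi(p)}p\big)^{-1}}{\prod_{p\le P}\big(1-\frac1p\big)^{-1}},$$ where $q'=q/b$, $\ell'=\ell/(\ell,b)$, $q''=(\ell',q')$, $\ell''=\ell'/q''$. As a consequence, $$\mathrm{Car}^{(P)}_\ell\, e_q(j\bullet)=\mathrm{Car}_\ell\, e_q(j\bullet)+O_q\Big(\frac1{\log P}\Big)=\mathbf 1_{\ell=q}\cdot\frac1{\varphi(q)}+O_q\Big(\frac1{\log P}\Big)$$ uniformly in all $\ell\in\mathbb N$: the implied constants depend only on $q$ (not on $j$, $\ell$ or the prime $P\ge q$). -/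

import Mathlib

open scoped ArithmeticFunction.Moebius

namespace CarmichaelSmooth

open Filter Topology

/-- The Ramanujan sum `c_q(a) = ∑_{h ≤ q, (h,q)=1} cos (2π h a / q)`. -/
noncomputable def ramanujanSum (q a : ℕ) : ℝ :=
  ∑ h ∈ (Finset.Icc 1 q).filter (fun h => Nat.Coprime h q),
    Real.cos (2 * Real.pi * (h : ℝ) * (a : ℝ) / (q : ℝ))

/-- The Eratosthenes transform `F' = F * μ` (Dirichlet convolution), for arguments `d ≥ 1`. -/
noncomputable def eratosthenes (F : ℕ → ℂ) (d : ℕ) : ℂ :=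
  ∑ x ∈ d.divisorsAntidiagonal, F x.1 * ((μ x.2 : ℤ) : ℂ)

/-- The `P`-smooth restriction `F_(P)(a) = ∑_{d ∈ (P), d ∣ a} F'(d)`.  In Mathlib,
`Nat.smoothNumbers (P + 1)` is the set of `n ≥ 1` all of whose prime factors are `≤ P`. -/
noncomputable def smoothRestriction (P : ℕ) (F : ℕ → ℂ) (a : ℕ) : ℂ :=
  ∑ d ∈ a.divisors.filter (fun d => d ∈ Nat.smoothNumbers (P + 1)), eratosthenes F d

/-- The averages `(1 / φ(ℓ)) (1 / x) ∑_{1 ≤ a ≤ x} F(a) c_ℓ(a)`, as a function of `x`. -/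
noncomputable def carmichaelAverage (F : ℕ → ℂ) (ℓ x : ℕ) : ℂ :=
  (1 / (Nat.totient ℓ : ℂ)) *
    ((1 / (x : ℂ)) * ∑ a ∈ Finset.Icc 1 x, F a * (ramanujanSum ℓ a : ℂ))

/-- The `ℓ`-th Carmichael coefficient of `F` exists. -/
def CarmichaelExists (F : ℕ → ℂ) (ℓ : ℕ) : Prop :=
  ∃ c : ℂ, Tendsto (carmichaelAverage F ℓ) atTop (𝓝 c)

/-- The `ℓ`-th Carmichael coefficient `Car_ℓ F` (meaningful if `CarmichaelExists F ℓ`). -/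
noncomputable def car (F : ℕ → ℂ) (ℓ : ℕ) : ℂ :=
  limUnder atTop (carmichaelAverage F ℓ)

/-- The `P`-smooth `ℓ`-th Carmichael coefficient of `F` exists. -/
def SmoothCarmichaelExists (P : ℕ) (F : ℕ → ℂ) (ℓ : ℕ) : Prop :=
  CarmichaelExists (smoothRestriction P F) ℓ

/-- The `P`-smooth `ℓ`-th Carmichael coefficient `Car_ℓ^(P) F = Car_ℓ F_(P)`. -/
noncomputable def smoothCar (P : ℕ) (F : ℕ → ℂ) (ℓ : ℕ) : ℂ :=
  car (smoothRestriction P F) ℓ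

/-- The imaginary exponential `a ↦ e_q(j a) = exp (2π i j a / q)`. -/
noncomputable def expFun (q : ℕ) (j : ℤ) (a : ℕ) : ℂ :=
  Complex.exp (2 * Real.pi * Complex.I * (j : ℂ) * (a : ℂ) / (q : ℂ))

/-- The Gauss sum `τ(χ) = ∑_{m mod n} χ(m) exp (2π i m / n)`. -/
noncomputable def tau {n : ℕ} [NeZero n] (χ : DirichletCharacter ℂ n) : ℂ :=
  gaussSum χ ZMod.stdAddChar

/-- The partial Euler product `∏_{p ≤ P} (1 - f(p) / p)⁻¹` over primes. -/
noncomputable def eulerProd (f : ℕ → ℂ) (P : ℕ) : ℂ :=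
  ∏ p ∈ Nat.primesLE P, (1 - f p / (p : ℂ))⁻¹

instance neZeroDiv (q : ℕ) [NeZero q] (b : q.divisors) : NeZero (q / (b : ℕ)) :=
  ⟨(Nat.div_pos (Nat.divisor_le b.2) (Nat.pos_of_mem_divisors b.2)).ne'⟩

/-- The summand of the explicit formula attached to a character `χ` modulo `q'`, with
`q'' = (ℓ', q')` and `ℓ'' = ℓ' / q''`; here `star χ` is the conjugate character. -/
noncomputable def charTerm {q' : ℕ} [NeZero q'] (χ : DirichletCharacter ℂ q')
    (j : ℤ) (P ℓ' : ℕ) : ℂ :=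
  let q'' : ℕ := Nat.gcd ℓ' q'
  let ℓ'' : ℕ := ℓ' / q''
  tau (star χ) * χ (j : ZMod q') *
    (((μ q'' : ℤ) : ℂ) * χ (ℓ'' : ZMod q') / (Nat.totient ℓ' : ℂ)) *
    (∏ p ∈ ℓ''.primeFactors, (1 - (star χ) (p : ZMod q'))) *
    (eulerProd (fun p => χ (p : ZMod q')) P / eulerProd (fun _ => 1) P)

end CarmichaelSmooth

open CarmichaelSmooth

/-!
Every `P`-smooth divisor of `a ≥ 1` divides the smooth part `a_P` of `a`, so Möbius inversion gives
`F_(P)(a) = F(a_P)` (`smoothRestriction_eq`), and the smooth Carmichael coefficients are mean values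
over the smooth part. The integers with `a_P = t` have density `1 / (t E)` with
`E = ∏_{p ≤ P} (1 - 1 / p)⁻¹`, and the proportion of those below `x` is at most `1 / t`, which is
summable over the smooth `t`. By dominated convergence the mean value of `G(a_P)` is
`E⁻¹ ∑ G(t) / t` for every bounded `G` (`hasMean_comp_smoothPart`).

If `ℓ` is smooth, then `c_ℓ(a) = c_ℓ(a_P)`, and `G(t) = e_q(j t) c_ℓ(t)` is to be summed. The
exponential is split as `c_q(t) / φ(q)`, its average over the units `j`, plus a remainder. The
average is again unaffected by passing to the smooth part, so its contribution is the mean value of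
`c_q c_ℓ / φ(q)`, which is the ordinary Carmichael mean value `1_{ℓ = q}`; no identity between
Euler products is needed for the principal characters. The remainder is expanded in the nonprincipal
characters modulo `q / b`, where `b = (q, t)` (`expFun_sub_eq_sum`). With
`c_ℓ(b s) = φ(ℓ) / φ(ℓ') c_ℓ'(s)` and Kluyver's formula for `c_ℓ'`, each character leads to an Euler
product times `∑_{d ∣ ℓ'} μ(ℓ' / d) χ(d)`, which `sum_moebius_char` evaluates.
If `ℓ` is not smooth, a translation argument shows that both coefficients vanish.

For the bound, `E ≥ log P`, and the Euler product of a nonprincipal `χ` must be shown to be bounded.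
This needs no nonvanishing of `L(1, χ)`. Moving the exponent from `1` to `σ = 1 + 1 / log P`
changes the products over `p ≤ P` by bounded factors, by Mertens' estimate for `∑ log p / p`
(`norm_eulerProd_le`). Since `|1 - χ(p) p^{-σ}|⁻¹ (1 - p^{-σ})⁻¹ ≥ 1`, the product of the truncated
Euler products of `L(σ, χ)` and `ζ(σ)` is at most `|L(σ, χ)| ζ(σ) = O(log P)`
(`exists_norm_eulerProd_div_le`).
-/

namespace CarmichaelSmooth

open Filter Topology

/-! ### Mean values -/

/-- `f` has mean value `M`: the averages of `f` over `1, …, x` tend to `M`. The value `f 0` plays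
no role. -/
def HasMean (f : ℕ → ℂ) (M : ℂ) : Prop :=
  Tendsto (fun x : ℕ => (1 / (x : ℂ)) * ∑ a ∈ Finset.Icc 1 x, f a) atTop (𝓝 M)

lemma HasMean.unique {f : ℕ → ℂ} {M M' : ℂ} (h : HasMean f M) (h' : HasMean f M') : M = M' :=
  tendsto_nhds_unique h h'

lemma HasMean.congr {f g : ℕ → ℂ} {M : ℂ} (h : HasMean f M) (hfg : ∀ a, 1 ≤ a → f a = g a) :
    HasMean g M := by
  have : (fun x : ℕ => (1 / (x : ℂ)) * ∑ a ∈ Finset.Icc 1 x, g a) =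
      (fun x : ℕ => (1 / (x : ℂ)) * ∑ a ∈ Finset.Icc 1 x, f a) := by
    funext x
    rw [Finset.sum_congr rfl fun a ha => hfg a (Finset.mem_Icc.1 ha).1]
  unfold HasMean
  rw [this]
  exact h

lemma HasMean.const_mul {f : ℕ → ℂ} {M : ℂ} (h : HasMean f M) (c : ℂ) :
    HasMean (fun a => c * f a) (c * M) := by
  refine (Tendsto.const_mul c h).congr fun x => ?_
  rw [← Finset.mul_sum]
  ring

lemma HasMean.add {f g : ℕ → ℂ} {M N : ℂ} (hf : HasMean f M) (hg : HasMean g N) :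
    HasMean (fun a => f a + g a) (M + N) := by
  refine (Tendsto.add hf hg).congr fun x => ?_
  rw [Finset.sum_add_distrib, mul_add]

lemma HasMean.sum {ι : Type*} (s : Finset ι) {f : ι → ℕ → ℂ} {M : ι → ℂ}
    (h : ∀ i ∈ s, HasMean (f i) (M i)) : HasMean (fun a => ∑ i ∈ s, f i a) (∑ i ∈ s, M i) := by
  refine (tendsto_finsetSum s h).congr fun x => ?_
  rw [Finset.sum_comm, Finset.mul_sum]

lemma hasMean_const (c : ℂ) : HasMean (fun _ => c) c := by
  refine Tendsto.congr' ?_ tendsto_const_nhds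
  filter_upwards [eventually_ge_atTop 1] with x hx
  have : (x : ℂ) ≠ 0 := by exact_mod_cast (by lia : x ≠ 0)
  simp [this]

/-- A bounded sequence divided by `x` tends to `0`. -/
lemma tendsto_inv_mul_of_bounded {u : ℕ → ℂ} {B : ℝ} (hu : ∀ x, ‖u x‖ ≤ B) :
    Tendsto (fun x : ℕ => (1 / (x : ℂ)) * u x) atTop (𝓝 0) := by
  refine squeeze_zero_norm (a := fun x : ℕ => B / (x : ℝ)) (fun x => ?_)
    (tendsto_const_div_atTop_nhds_zero_nat B)
  rw [norm_mul, norm_div, norm_one, Complex.norm_natCast, div_mul_eq_mul_div, one_mul]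
  gcongr
  exact hu x

lemma bounded_of_periodic {u : ℕ → ℂ} {N : ℕ} (hN : 0 < N) (hu : Function.Periodic u N) :
    ∃ B : ℝ, ∀ x, ‖u x‖ ≤ B := by
  refine ⟨∑ i ∈ Finset.range N, ‖u i‖, fun x => ?_⟩
  rw [← hu.map_mod_nat x]
  exact Finset.single_le_sum (f := fun i => ‖u i‖) (fun i _ => norm_nonneg _)
    (Finset.mem_range.2 (Nat.mod_lt _ hN))

lemma sum_Icc_add_period {f : ℕ → ℂ} {N : ℕ} (hf : Function.Periodic f N) (x : ℕ) :
    ∑ a ∈ Finset.Icc 1 (x + N), f a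
      = ∑ a ∈ Finset.Icc 1 x, f a + ∑ a ∈ Finset.Icc 1 N, f a := by
  induction x with
  | zero => simp
  | succ x ih =>
    rw [show x + 1 + N = x + N + 1 by ring, Finset.sum_Icc_succ_top (by lia), ih,
      Finset.sum_Icc_succ_top (by lia), show x + N + 1 = x + 1 + N by ring, hf (x + 1)]
    ring

/-- A periodic function has a mean value: its partial sums differ from a linear function by a
periodic, hence bounded, function. -/
lemma exists_hasMean_of_periodic {f : ℕ → ℂ} {N : ℕ} (hN : 0 < N) (hf : Function.Periodic f N) :
    ∃ M, HasMean f M := by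
  have hN' : (N : ℂ) ≠ 0 := by exact_mod_cast hN.ne'
  set T := ∑ a ∈ Finset.Icc 1 N, f a with hT
  set u : ℕ → ℂ := fun x => ∑ a ∈ Finset.Icc 1 x, f a - x * (T / N) with hu
  have hper : Function.Periodic u N := by
    intro x
    simp only [hu]
    rw [sum_Icc_add_period hf x]
    push_cast
    field_simp
    ring
  obtain ⟨B, hB⟩ := bounded_of_periodic hN hper
  refine ⟨T / N, ?_⟩
  have h1 := (tendsto_inv_mul_of_bounded hB).add_const (T / N)
  rw [zero_add] at h1
  refine Tendsto.congr' ?_ h1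
  filter_upwards [eventually_ge_atTop 1] with x hx
  have : (x : ℂ) ≠ 0 := by exact_mod_cast (by lia : x ≠ 0)
  simp only [hu]
  field_simp
  ring

lemma HasMean.shift {f : ℕ → ℂ} {M : ℂ} (hf : HasMean f M) (N : ℕ) :
    HasMean (fun a => f (a + N)) M := by
  have hsum : ∀ x : ℕ, ∑ a ∈ Finset.Icc 1 x, f (a + N)
      = ∑ a ∈ Finset.Icc 1 (x + N), f a - ∑ a ∈ Finset.Icc 1 N, f a := by
    intro x
    induction x with
    | zero => simp
    | succ x ih =>
      rw [Finset.sum_Icc_succ_top (by lia), ih, show x + 1 + N = x + N + 1 by ring,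
        Finset.sum_Icc_succ_top (by lia)]
      ring
  have h1 : Tendsto (fun x : ℕ => (1 / ((x + N : ℕ) : ℂ)) * ∑ a ∈ Finset.Icc 1 (x + N), f a)
      atTop (𝓝 M) := (tendsto_add_atTop_iff_nat N).2 hf
  have h2 : Tendsto (fun x : ℕ => 1 + (1 / (x : ℂ)) * N) atTop (𝓝 (1 + 0)) :=
    (tendsto_inv_mul_of_bounded (u := fun _ => (N : ℂ)) (fun _ => le_rfl)).const_add 1
  have h3 := (h2.mul h1).sub (tendsto_inv_mul_of_bounded
    (u := fun _ => ∑ a ∈ Finset.Icc 1 N, f a) (fun _ => le_rfl))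
  simp only [add_zero, one_mul, sub_zero] at h3
  refine Tendsto.congr' ?_ h3
  filter_upwards [eventually_ge_atTop 1] with x hx
  have hx0 : (x : ℂ) ≠ 0 := by exact_mod_cast (by lia : x ≠ 0)
  have hxN : ((x : ℂ) + N) ≠ 0 := by exact_mod_cast (by lia : x + N ≠ 0)
  rw [hsum]
  push_cast
  field_simp

/-- A function that a translation multiplies by a constant `ζ ≠ 1` has no other mean value
than `0`. -/
lemma HasMean.eq_zero_of_twist {f : ℕ → ℂ} {M ζ : ℂ} {N : ℕ} (hf : HasMean f M) (hζ : ζ ≠ 1)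
    (h : ∀ a, f (a + N) = ζ * f a) : M = 0 := by
  have h1 : HasMean (fun a => ζ * f a) M := (hf.shift N).congr fun a _ => h a
  have h2 := h1.unique (hf.const_mul ζ)
  have h3 : (ζ - 1) * M = 0 := by linear_combination -h2
  exact (mul_eq_zero.1 h3).resolve_left (sub_ne_zero.2 hζ)

lemma sum_Icc_dilate (g : ℕ → ℂ) {t : ℕ} (ht : 0 < t) (x : ℕ) :
    ∑ a ∈ Finset.Icc 1 x, (if t ∣ a then g (a / t) else 0) = ∑ m ∈ Finset.Icc 1 (x / t), g m := by
  rw [← Finset.sum_filter]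
  symm
  refine Finset.sum_bij (fun m _ => t * m) ?_ ?_ ?_ ?_
  · intro m hm
    rw [Finset.mem_Icc] at hm
    rw [Finset.mem_filter, Finset.mem_Icc]
    refine ⟨⟨Nat.mul_pos ht hm.1, ?_⟩, dvd_mul_right _ _⟩
    rw [mul_comm]
    exact (Nat.le_div_iff_mul_le ht).1 hm.2
  · intro a _ b _ hab
    exact Nat.eq_of_mul_eq_mul_left ht hab
  · intro a ha
    rw [Finset.mem_filter, Finset.mem_Icc] at ha
    obtain ⟨⟨h1, h2⟩, m, rfl⟩ := ha
    refine ⟨m, ?_, rfl⟩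
    rw [Finset.mem_Icc]
    refine ⟨Nat.pos_of_mul_pos_left h1, ?_⟩
    rw [Nat.le_div_iff_mul_le ht, mul_comm]
    exact h2
  · intro m _
    rw [Nat.mul_div_cancel_left _ ht]

lemma HasMean.dilate {g : ℕ → ℂ} {M : ℂ} (hg : HasMean g M) {t : ℕ} (ht : 0 < t) :
    HasMean (fun a => if t ∣ a then g (a / t) else 0) (M / t) := by
  have ht' : (t : ℂ) ≠ 0 := by exact_mod_cast ht.ne'
  have hlim : Tendsto (fun x : ℕ => x / t) atTop atTop :=
    Nat.tendsto_div_const_atTop ht.ne'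
  have h1 := hg.comp hlim
  have h2 : Tendsto (fun x : ℕ => (1 / (t : ℂ)) - (1 / (x : ℂ)) * (((x % t : ℕ) : ℂ) / t))
      atTop (𝓝 (1 / (t : ℂ) - 0)) := by
    refine Tendsto.const_sub _ (tendsto_inv_mul_of_bounded (B := 1) fun x => ?_)
    rw [norm_div, Complex.norm_natCast, Complex.norm_natCast]
    refine div_le_one_of_le₀ ?_ (Nat.cast_nonneg _)
    exact_mod_cast (Nat.mod_lt x ht).le
  have h3 := h2.mul h1
  rw [sub_zero, one_div_mul_eq_div] at h3
  refine Tendsto.congr' ?_ h3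
  filter_upwards [eventually_ge_atTop t] with x hx
  rw [sum_Icc_dilate g ht]
  simp only [Function.comp]
  have hx0 : (x : ℂ) ≠ 0 := by exact_mod_cast (by lia : x ≠ 0)
  have hxt : ((x / t : ℕ) : ℂ) ≠ 0 := by exact_mod_cast (Nat.div_pos hx ht).ne'
  have hx1 : (x : ℂ) = t * ((x / t : ℕ) : ℂ) + ((x % t : ℕ) : ℂ) := by
    exact_mod_cast (Nat.div_add_mod x t).symm
  have : (1 / (t : ℂ)) - (1 / (x : ℂ)) * (((x % t : ℕ) : ℂ) / t)
      = ((x / t : ℕ) : ℂ) / x := by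
    have : ((x % t : ℕ) : ℂ) = x - t * ((x / t : ℕ) : ℂ) := by linear_combination -hx1
    rw [this]
    field_simp
    ring
  rw [this]
  field_simp

lemma tendsto_carmichaelAverage {F : ℕ → ℂ} {ℓ : ℕ} {M : ℂ}
    (h : HasMean (fun a => F a * (ramanujanSum ℓ a : ℂ)) M) :
    Tendsto (carmichaelAverage F ℓ) atTop (𝓝 (1 / (Nat.totient ℓ : ℂ) * M)) :=
  Tendsto.const_mul _ h

lemma car_eq_of_hasMean {F : ℕ → ℂ} {ℓ : ℕ} {M : ℂ}
    (h : HasMean (fun a => F a * (ramanujanSum ℓ a : ℂ)) M) :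
    car F ℓ = 1 / (Nat.totient ℓ : ℂ) * M :=
  (tendsto_carmichaelAverage h).limUnder_eq

lemma carmichaelExists_of_hasMean {F : ℕ → ℂ} {ℓ : ℕ} {M : ℂ}
    (h : HasMean (fun a => F a * (ramanujanSum ℓ a : ℂ)) M) : CarmichaelExists F ℓ :=
  ⟨_, tendsto_carmichaelAverage h⟩

/-! ### The smooth part of an integer -/

lemma mem_smooth_iff {P n : ℕ} :
    n ∈ Nat.smoothNumbers (P + 1) ↔ ∀ p, p.Prime → p ∣ n → p ≤ P := by
  rw [Nat.mem_smoothNumbers']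
  simp only [Nat.lt_succ_iff]

lemma prime_mem_smooth {P p : ℕ} (hp : p.Prime) (hpP : p ≤ P) : p ∈ Nat.smoothNumbers (P + 1) :=
  Nat.mem_smoothNumbers_of_lt hp.pos (by lia)

lemma one_mem_smooth (P : ℕ) : 1 ∈ Nat.smoothNumbers (P + 1) := by
  simp [Nat.mem_smoothNumbers]

lemma prod_mem_smooth {ι : Type*} {P : ℕ} (s : Finset ι) {f : ι → ℕ}
    (h : ∀ i ∈ s, f i ∈ Nat.smoothNumbers (P + 1)) :
    ∏ i ∈ s, f i ∈ Nat.smoothNumbers (P + 1) :=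
  Finset.prod_induction f (· ∈ Nat.smoothNumbers (P + 1))
    (fun _ _ => Nat.mul_mem_smoothNumbers) (one_mem_smooth P) h

/-- The `P`-smooth part of `a ≥ 1`, defined as the least common multiple of the `P`-smooth
divisors of `a`. -/
noncomputable def smoothPart (P a : ℕ) : ℕ :=
  (a.divisors.filter (fun d => d ∈ Nat.smoothNumbers (P + 1))).lcm id

lemma smoothPart_dvd (P a : ℕ) : smoothPart P a ∣ a := by
  refine Finset.lcm_dvd fun d hd => ?_
  exact Nat.dvd_of_mem_divisors (Finset.mem_filter.1 hd).1

lemma dvd_smoothPart {P a d : ℕ} (ha : a ≠ 0) (hd : d ∈ Nat.smoothNumbers (P + 1)) (h : d ∣ a) :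
    d ∣ smoothPart P a :=
  Finset.dvd_lcm (f := id) (Finset.mem_filter.2 ⟨Nat.mem_divisors.2 ⟨h, ha⟩, hd⟩)

lemma smoothPart_mem (P a : ℕ) : smoothPart P a ∈ Nat.smoothNumbers (P + 1) := by
  refine Nat.mem_smoothNumbers_of_dvd (prod_mem_smooth
    (a.divisors.filter (fun d => d ∈ Nat.smoothNumbers (P + 1))) (f := id)
    fun d hd => (Finset.mem_filter.1 hd).2) ?_
  exact Finset.lcm_dvd fun d hd => Finset.dvd_prod_of_mem id hd

lemma dvd_smoothPart_iff {P a d : ℕ} (ha : a ≠ 0) (hd : d ∈ Nat.smoothNumbers (P + 1)) :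
    d ∣ smoothPart P a ↔ d ∣ a :=
  ⟨fun h => h.trans (smoothPart_dvd P a), dvd_smoothPart ha hd⟩

/-- `t` is the smooth part of `a` exactly when it divides `a` and no prime `p ≤ P` can be added
to it. For fixed `t` the right-hand side is periodic in `a`. -/
lemma smoothPart_eq_iff {P a t : ℕ} (ha : a ≠ 0) (ht : t ∈ Nat.smoothNumbers (P + 1)) :
    smoothPart P a = t ↔ t ∣ a ∧ ∀ p ∈ Nat.primesLE P, ¬ t * p ∣ a := by
  have ht0 : t ≠ 0 := Nat.ne_zero_of_mem_smoothNumbers ht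
  constructor
  · rintro rfl
    refine ⟨smoothPart_dvd P a, fun p hp hdvd => ?_⟩
    rw [Nat.mem_primesLE] at hp
    have := dvd_smoothPart ha
      (Nat.mul_mem_smoothNumbers ht (prime_mem_smooth hp.2 hp.1)) hdvd
    have := Nat.le_of_dvd (Nat.pos_of_ne_zero ht0) this
    nlinarith [hp.2.two_le, Nat.pos_of_ne_zero ht0]
  · rintro ⟨h1, h2⟩
    obtain ⟨k, hk⟩ := dvd_smoothPart ha ht h1
    by_cases hk1 : k = 1
    · rw [hk, hk1, mul_one]
    · obtain ⟨p, hp, hpk⟩ := Nat.exists_prime_and_dvd hk1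
      have hpt : t * p ∣ smoothPart P a := hk ▸ mul_dvd_mul_left t hpk
      refine absurd (hpt.trans (smoothPart_dvd P a)) (h2 p (Nat.mem_primesLE.2 ⟨?_, hp⟩))
      exact mem_smooth_iff.1 (smoothPart_mem P a) p hp ((dvd_mul_left p t).trans hpt)

lemma smoothPart_le {P a : ℕ} (ha : a ≠ 0) : smoothPart P a ≤ a :=
  Nat.le_of_dvd (Nat.pos_of_ne_zero ha) (smoothPart_dvd P a)

lemma sum_divisors_eratosthenes (F : ℕ → ℂ) {n : ℕ} (hn : 0 < n) :
    ∑ d ∈ n.divisors, eratosthenes F d = F n := by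
  refine (ArithmeticFunction.sum_eq_iff_sum_mul_moebius_eq (f := eratosthenes F) (g := F)).2
    (fun m _ => ?_) n hn
  rw [eratosthenes]
  refine Finset.sum_equiv (Equiv.prodComm ℕ ℕ) (fun x => ?_) fun x _ => mul_comm _ _
  exact Nat.swap_mem_divisorsAntidiagonal.symm

/-- The `P`-smooth restriction of `F` is `F` evaluated at the `P`-smooth part. -/
lemma smoothRestriction_eq (P : ℕ) (F : ℕ → ℂ) {a : ℕ} (ha : a ≠ 0) :
    smoothRestriction P F a = F (smoothPart P a) := by
  have h0 := Nat.ne_zero_of_mem_smoothNumbers (smoothPart_mem P a)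
  rw [← sum_divisors_eratosthenes F (Nat.pos_of_ne_zero h0), smoothRestriction]
  refine Finset.sum_congr ?_ fun _ _ => rfl
  ext d
  rw [Finset.mem_filter, Nat.mem_divisors, Nat.mem_divisors]
  constructor
  · rintro ⟨⟨h1, _⟩, h2⟩
    exact ⟨dvd_smoothPart ha h2 h1, h0⟩
  · rintro ⟨h1, _⟩
    exact ⟨⟨h1.trans (smoothPart_dvd P a), ha⟩,
      Nat.mem_smoothNumbers_of_dvd (smoothPart_mem P a) h1⟩

/-! ### Sums over smooth numbers -/

/-- The sum of `f t / t` over the `P`-smooth numbers `t` converges to `S`. -/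
def HasSmoothSum (P : ℕ) (f : ℕ → ℂ) (S : ℂ) : Prop :=
  HasSum ((Nat.smoothNumbers (P + 1)).indicator fun t => f t / (t : ℂ)) S

lemma HasSmoothSum.congr {P : ℕ} {f g : ℕ → ℂ} {S : ℂ} (hf : HasSmoothSum P f S)
    (h : ∀ t ∈ Nat.smoothNumbers (P + 1), f t = g t) : HasSmoothSum P g S := by
  have : (Nat.smoothNumbers (P + 1)).indicator (fun t => g t / (t : ℂ)) =
      (Nat.smoothNumbers (P + 1)).indicator fun t => f t / (t : ℂ) :=
    Set.indicator_congr fun t ht => by rw [h t ht]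
  unfold HasSmoothSum
  rw [this]
  exact hf

lemma HasSmoothSum.const_mul {P : ℕ} {f : ℕ → ℂ} {S : ℂ} (hf : HasSmoothSum P f S) (c : ℂ) :
    HasSmoothSum P (fun t => c * f t) (c * S) := by
  refine (HasSum.mul_left c hf).congr_fun fun t => ?_
  simp only [Set.indicator_apply]
  split_ifs <;> ring

lemma HasSmoothSum.sum {P : ℕ} {ι : Type*} (s : Finset ι) {f : ι → ℕ → ℂ} {S : ι → ℂ}
    (h : ∀ i ∈ s, HasSmoothSum P (f i) (S i)) :
    HasSmoothSum P (fun t => ∑ i ∈ s, f i t) (∑ i ∈ s, S i) := by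
  refine (hasSum_sum h).congr_fun fun t => ?_
  simp only [Set.indicator_apply]
  split_ifs
  · rw [Finset.sum_div]
  · simp

lemma HasSmoothSum.dilate {P : ℕ} {f : ℕ → ℂ} {S : ℂ} (hf : HasSmoothSum P f S) {b : ℕ}
    (hb : b ∈ Nat.smoothNumbers (P + 1)) :
    HasSmoothSum P (fun t => if b ∣ t then f (t / b) else 0) (S / b) := by
  have hb0 : b ≠ 0 := Nat.ne_zero_of_mem_smoothNumbers hb
  have hb' : (b : ℂ) ≠ 0 := by exact_mod_cast hb0
  have hinj : Function.Injective fun s : ℕ => b * s := fun _ _ h =>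
    Nat.eq_of_mul_eq_mul_left (Nat.pos_of_ne_zero hb0) h
  refine (hinj.hasSum_iff fun t ht => ?_).1 ?_
  · have hbt : ¬ b ∣ t := by
      rintro ⟨s, rfl⟩
      exact ht ⟨s, rfl⟩
    simp [Set.indicator_apply, hbt]
  · refine (HasSum.div_const hf (b : ℂ)).congr_fun fun s => ?_
    have hiff : b * s ∈ Nat.smoothNumbers (P + 1) ↔ s ∈ Nat.smoothNumbers (P + 1) :=
      ⟨fun h => Nat.mem_smoothNumbers_of_dvd h (dvd_mul_left s b), Nat.mul_mem_smoothNumbers hb⟩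
    simp only [Function.comp, Set.indicator_apply, hiff, dvd_mul_right, if_true,
      Nat.mul_div_cancel_left s (Nat.pos_of_ne_zero hb0)]
    split_ifs
    · push_cast
      rw [div_div, mul_comm (b : ℂ)]
    · simp

/-- The Euler product over `p ≤ P` for a completely multiplicative `f` bounded by `1`. -/
lemma hasSmoothSum_eulerProd (P : ℕ) (f : ℕ →* ℂ) (hf : ∀ n, ‖f n‖ ≤ 1) :
    HasSmoothSum P f (eulerProd f P) := by
  let g : ℕ →* ℂ :=
    { toFun := fun n => f n / n
      map_one' := by simp
      map_mul' := fun m n => by simp [mul_div_mul_comm] }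
  have hg : ∀ {p : ℕ}, p.Prime → ‖g p‖ < 1 := by
    intro p hp
    change ‖f p / p‖ < 1
    have h2 : (1 : ℝ) < p := by exact_mod_cast hp.one_lt
    rw [norm_div, Complex.norm_natCast, div_lt_one (by linarith)]
    exact (hf p).trans_lt h2
  exact hasSum_subtype_iff_indicator.1
    (EulerProduct.summable_and_hasSum_smoothNumbers_prod_primesBelow_geometric hg (P + 1)).2

lemma hasSmoothSum_one (P : ℕ) : HasSmoothSum P (fun _ => 1) (eulerProd (fun _ => 1) P) :=
  hasSmoothSum_eulerProd P 1 fun n => by simp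

lemma summable_smooth_inv (P : ℕ) :
    Summable ((Nat.smoothNumbers (P + 1)).indicator fun t => 1 / (t : ℝ)) := by
  refine (hasSmoothSum_one P).summable.norm.congr fun t => ?_
  simp only [Set.indicator_apply]
  split_ifs <;> simp

lemma eulerProd_one_ne_zero (P : ℕ) : eulerProd (fun _ => 1) P ≠ 0 := by
  refine Finset.prod_ne_zero_iff.2 fun p hp => inv_ne_zero (sub_ne_zero.2 ?_)
  have hp1 : (p : ℂ) ≠ 0 := by exact_mod_cast (Nat.prime_of_mem_primesLE hp).ne_zero
  have hp2 : (p : ℂ) ≠ 1 := by exact_mod_cast (Nat.prime_of_mem_primesLE hp).ne_one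
  rw [Ne, eq_div_iff hp1, one_mul]
  exact hp2

/-! ### Mean values over the smooth part -/

/-- Sorting the integers by their smooth part `t`: a proportion at most `1 / t` of them has smooth
part `t`, and `∑ 1 / t` over the smooth `t` converges, so the limit may be taken for every `t`
separately. -/
lemma hasMean_smoothPart {P : ℕ} {F H M : ℕ → ℂ} {A B : ℝ} (hF : ∀ a, ‖F a‖ ≤ A)
    (hH : ∀ a, ‖H a‖ ≤ B)
    (hM : ∀ t ∈ Nat.smoothNumbers (P + 1), HasMean (fun a => if smoothPart P a = t then H a else 0)
      (M t)) :
    HasMean (fun a => F (smoothPart P a) * H a)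
      (∑' t, (Nat.smoothNumbers (P + 1)).indicator (fun t => F t * M t) t) := by
  have hA : 0 ≤ A := (norm_nonneg _).trans (hF 0)
  have hB : 0 ≤ B := (norm_nonneg _).trans (hH 0)
  let f : ℕ → ℕ → ℂ := fun x t => (Nat.smoothNumbers (P + 1)).indicator (fun t => F t *
    ((1 / (x : ℂ)) * ∑ a ∈ Finset.Icc 1 x, if smoothPart P a = t then H a else 0)) t
  have hsum : ∀ x : ℕ, (1 / (x : ℂ)) * ∑ a ∈ Finset.Icc 1 x, F (smoothPart P a) * H a
      = ∑' t, f x t := by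
    intro x
    rw [tsum_eq_sum (s := Finset.Icc 1 x)]
    · have : ∀ t ∈ Finset.Icc 1 x, f x t = (1 / (x : ℂ)) *
          ∑ a ∈ Finset.Icc 1 x, if smoothPart P a = t then F (smoothPart P a) * H a else 0 := by
        intro t _
        simp only [f]
        by_cases ht : t ∈ Nat.smoothNumbers (P + 1)
        · rw [Set.indicator_of_mem ht, mul_left_comm, Finset.mul_sum]
          congr 1
          refine Finset.sum_congr rfl fun a _ => ?_
          split_ifs with h
          · rw [h]
          · rw [mul_zero]
        · rw [Set.indicator_of_notMem ht, Finset.sum_eq_zero, mul_zero]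
          intro a _
          rw [if_neg]
          rintro rfl
          exact ht (smoothPart_mem P a)
      rw [Finset.sum_congr rfl this, ← Finset.mul_sum, Finset.sum_comm]
      congr 1
      refine Finset.sum_congr rfl fun a ha => ?_
      rw [Finset.sum_ite_eq, if_pos]
      rw [Finset.mem_Icc] at ha ⊢
      exact ⟨Nat.pos_of_ne_zero (Nat.ne_zero_of_mem_smoothNumbers (smoothPart_mem P a)),
        (smoothPart_le (by lia)).trans ha.2⟩
    · intro t ht
      simp only [f, Set.indicator_apply]
      split_ifs with hts
      · rw [Finset.sum_eq_zero, mul_zero, mul_zero]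
        intro a ha
        rw [if_neg]
        rintro rfl
        rw [Finset.mem_Icc] at ha ht
        exact ht ⟨Nat.pos_of_ne_zero (Nat.ne_zero_of_mem_smoothNumbers hts),
          (smoothPart_le (by lia)).trans ha.2⟩
      · rfl
  unfold HasMean
  simp only [hsum]
  refine tendsto_tsum_of_dominated_convergence
    ((summable_smooth_inv P).mul_left (A * B)) (fun t => ?_) (Eventually.of_forall fun x t => ?_)
  · simp only [f]
    by_cases ht : t ∈ Nat.smoothNumbers (P + 1)
    · simp only [Set.indicator_of_mem ht]
      exact Tendsto.const_mul _ (hM t ht)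
    · simp only [Set.indicator_of_notMem ht]
      exact tendsto_const_nhds
  · simp only [f]
    by_cases ht : t ∈ Nat.smoothNumbers (P + 1)
    · rw [Set.indicator_of_mem ht, Set.indicator_of_mem ht]
      have ht0 : 0 < t := Nat.pos_of_ne_zero (Nat.ne_zero_of_mem_smoothNumbers ht)
      have hcount : ‖∑ a ∈ Finset.Icc 1 x, if smoothPart P a = t then H a else 0‖
          ≤ B * (x / t : ℝ) := by
        have h1 : ∀ a ∈ Finset.Icc 1 x, ‖if smoothPart P a = t then H a else 0‖
            ≤ B * ‖if t ∣ a then (1 : ℂ) else 0‖ := by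
          intro a _
          split_ifs with h h' h'
          · simpa using hH a
          · exact absurd (h ▸ smoothPart_dvd P a) h'
          · simpa using hB
          · simp
        refine (norm_sum_le_of_le _ h1).trans ?_
        rw [← Finset.mul_sum]
        refine mul_le_mul_of_nonneg_left ?_ hB
        have h2 : ∑ a ∈ Finset.Icc 1 x, ‖if t ∣ a then (1 : ℂ) else 0‖ = ((x / t : ℕ) : ℝ) := by
          have := sum_Icc_dilate (fun _ => 1) ht0 x
          simp only [Finset.sum_const, Nat.card_Icc, Nat.add_sub_cancel, nsmul_eq_mul,
            mul_one] at this
          have h3 : ∀ a, ((‖if t ∣ a then (1 : ℂ) else 0‖ : ℝ) : ℂ) = if t ∣ a then 1 else 0 := by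
            intro a
            split_ifs <;> simp
          have h4 : ((∑ a ∈ Finset.Icc 1 x, ‖if t ∣ a then (1 : ℂ) else 0‖ : ℝ) : ℂ)
              = ((x / t : ℕ) : ℂ) := by
            rw [← this]
            push_cast
            exact Finset.sum_congr rfl fun a _ => h3 a
          exact_mod_cast h4
        rw [h2]
        exact Nat.cast_div_le
      rw [norm_mul, norm_mul, norm_div, norm_one, Complex.norm_natCast]
      calc ‖F t‖ * (1 / (x : ℝ) * ‖∑ a ∈ Finset.Icc 1 x, if smoothPart P a = t then H a else 0‖)
          ≤ A * (1 / (x : ℝ) * (B * (x / t : ℝ))) := by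
            gcongr
            exact hF t
        _ = A * B * ((x : ℝ) / x) * (1 / t) := by ring
        _ ≤ A * B * 1 * (1 / t) := by
            gcongr
            exact div_self_le_one _
        _ = A * B * (1 / t) := by ring
    · rw [Set.indicator_of_notMem ht, Set.indicator_of_notMem ht]
      simp

lemma dvd_and_forall_not_dvd_add_iff {P t N : ℕ} (hN : t * ∏ p ∈ Nat.primesLE P, p ∣ N) (a : ℕ) :
    (t ∣ a + N ∧ ∀ p ∈ Nat.primesLE P, ¬ t * p ∣ a + N) ↔
      (t ∣ a ∧ ∀ p ∈ Nat.primesLE P, ¬ t * p ∣ a) := by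
  rw [Nat.dvd_add_left ((dvd_mul_right t _).trans hN)]
  refine and_congr_right fun _ => forall₂_congr fun p hp => ?_
  rw [Nat.dvd_add_left ((mul_dvd_mul_left t (Finset.dvd_prod_of_mem _ hp)).trans hN)]

lemma prod_primesLE_pos (P : ℕ) : 0 < ∏ p ∈ Nat.primesLE P, p :=
  Finset.prod_pos fun _ hp => (Nat.prime_of_mem_primesLE hp).pos

/-- The integers with smooth part `t` have density `1 / (t E)`, where `E = ∏ (1 - 1 / p)⁻¹`. By
dilation the density is `δ / t` with `δ` independent of `t`, and these densities add up to `1`. -/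
lemma hasMean_smoothPart_eq {P t : ℕ} (ht : t ∈ Nat.smoothNumbers (P + 1)) :
    HasMean (fun a => if smoothPart P a = t then 1 else 0)
      (1 / (eulerProd (fun _ => 1) P * t)) := by
  obtain ⟨δ, hδ⟩ : ∃ δ, HasMean (fun a => if smoothPart P a = 1 then 1 else 0) δ := by
    obtain ⟨δ, hδ⟩ := exists_hasMean_of_periodic (prod_primesLE_pos P)
      (f := fun a => if 1 ∣ a ∧ ∀ p ∈ Nat.primesLE P, ¬ 1 * p ∣ a then 1 else 0) (fun a => by
        simp only [dvd_and_forall_not_dvd_add_iff (P := P) (t := 1) (by rw [one_mul])])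
    refine ⟨δ, hδ.congr fun a ha => ?_⟩
    simp only [smoothPart_eq_iff (P := P) (a := a) (by lia) (one_mem_smooth P)]
  have hdil : ∀ t ∈ Nat.smoothNumbers (P + 1),
      HasMean (fun a => if smoothPart P a = t then 1 else 0) (δ / t) := by
    intro t ht
    have ht0 : 0 < t := Nat.pos_of_ne_zero (Nat.ne_zero_of_mem_smoothNumbers ht)
    refine (hδ.dilate ht0).congr fun a ha => ?_
    by_cases hta : t ∣ a
    · obtain ⟨m, rfl⟩ := hta
      have hm : m ≠ 0 := by
        rintro rfl
        simp at ha
      rw [if_pos (dvd_mul_right t m), Nat.mul_div_cancel_left m ht0]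
      simp only [smoothPart_eq_iff hm (one_mem_smooth P),
        smoothPart_eq_iff (mul_ne_zero ht0.ne' hm) ht, one_dvd, one_mul, dvd_mul_right,
        Nat.mul_dvd_mul_iff_left ht0]
    · rw [if_neg hta, if_neg]
      rintro rfl
      exact hta (smoothPart_dvd P a)
  have h1 := hasMean_smoothPart (F := fun _ => 1) (H := fun _ => 1) (A := 1) (B := 1)
    (fun _ => by simp) (fun _ => by simp) hdil
  have h2 := (hasSmoothSum_one P).const_mul δ
  have h3 : (1 : ℂ) = δ * eulerProd (fun _ => 1) P := by
    refine (hasMean_const 1).unique ?_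
    rw [← h2.tsum_eq]
    simpa using h1
  have hE := eulerProd_one_ne_zero P
  have hδE : δ = 1 / eulerProd (fun _ => 1) P := by
    rw [eq_div_iff hE]
    exact h3.symm
  have := hdil t ht
  rwa [hδE, div_div] at this

lemma hasMean_comp_smoothPart {P : ℕ} {F : ℕ → ℂ} {A : ℝ} (hF : ∀ a, ‖F a‖ ≤ A) {S : ℂ}
    (hS : HasSmoothSum P F S) :
    HasMean (fun a => F (smoothPart P a)) (S / eulerProd (fun _ => 1) P) := by
  have h1 := hasMean_smoothPart (H := fun _ => 1) (B := 1) hF (fun _ => by simp)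
    fun t ht => hasMean_smoothPart_eq (P := P) ht
  have h2 := hS.const_mul (1 / eulerProd (fun _ => 1) P)
  rw [one_div_mul_eq_div] at h2
  have h3 : ∑' t, (Nat.smoothNumbers (P + 1)).indicator
      (fun t => F t * (1 / (eulerProd (fun _ => 1) P * t))) t = S / eulerProd (fun _ => 1) P := by
    rw [← h2.tsum_eq]
    congr 1
    funext t
    simp only [Set.indicator_apply]
    split_ifs
    · rw [div_mul_eq_div_div]
      ring
    · rfl
  rw [h3] at h1
  simpa using h1

/-! ### Ramanujan sums -/

lemma sum_Icc_natCast_zmod (n : ℕ) [NeZero n] (g : ZMod n → ℂ) :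
    ∑ h ∈ Finset.Icc 1 n, g (h : ZMod n) = ∑ z : ZMod n, g z := by
  refine Finset.sum_bij (fun h _ => (h : ZMod n)) (fun _ _ => Finset.mem_univ _) ?_ ?_
    (fun _ _ => rfl)
  · intro a ha b hb hab
    rw [Finset.mem_Icc] at ha hb
    have h1 := (Nat.modEq_iff_dvd.1 ((ZMod.natCast_eq_natCast_iff a b n).1 hab))
    have h2 := Int.eq_zero_of_abs_lt_dvd h1 (by rw [abs_lt]; constructor <;> lia)
    lia
  · intro z _
    by_cases hz : z.val = 0
    · refine ⟨n, Finset.mem_Icc.2 ⟨NeZero.one_le, le_rfl⟩, ?_⟩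
      rw [ZMod.natCast_self, (ZMod.val_eq_zero z).1 hz]
    · exact ⟨z.val, Finset.mem_Icc.2 ⟨by lia, (ZMod.val_lt z).le⟩, ZMod.natCast_zmod_val z⟩

lemma sum_units_eq (n : ℕ) [NeZero n] (g : ZMod n → ℂ) :
    ∑ u : (ZMod n)ˣ, g u = ∑ h ∈ (Finset.Icc 1 n).filter (fun h => Nat.Coprime h n), g h := by
  classical
  have h1 : ∑ u : (ZMod n)ˣ, g u = ∑ z : ZMod n, if IsUnit z then g z else 0 := by
    rw [← Finset.sum_filter]
    refine Finset.sum_bij (fun u _ => (u : ZMod n)) ?_ ?_ ?_ fun _ _ => rfl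
    · intro u _
      exact Finset.mem_filter.2 ⟨Finset.mem_univ _, u.isUnit⟩
    · intro u _ v _ h
      exact Units.ext h
    · intro z hz
      exact ⟨(Finset.mem_filter.1 hz).2.unit, Finset.mem_univ _, rfl⟩
  rw [h1, ← sum_Icc_natCast_zmod, Finset.sum_filter]
  refine Finset.sum_congr rfl fun h _ => ?_
  simp only [ZMod.isUnit_iff_coprime]

lemma cos_eq_re_stdAddChar (n : ℕ) [NeZero n] (h a : ℕ) :
    Real.cos (2 * Real.pi * (h : ℝ) * (a : ℝ) / (n : ℝ))
      = (ZMod.stdAddChar ((h : ZMod n) * (a : ZMod n))).re := by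
  have : ((h : ZMod n) * (a : ZMod n)) = (((h * a : ℕ) : ℤ) : ZMod n) := by push_cast; rfl
  rw [this, ZMod.stdAddChar_coe, ← Complex.exp_ofReal_mul_I_re]
  congr 2
  push_cast
  ring

/-- The Ramanujan sum as a sum of additive characters over the units modulo `n`. -/
lemma ramanujanSum_eq_sum_units (n : ℕ) [NeZero n] (a : ℕ) :
    (ramanujanSum n a : ℂ) = ∑ u : (ZMod n)ˣ, ZMod.stdAddChar ((u : ZMod n) * (a : ZMod n)) := by
  set S := ∑ u : (ZMod n)ˣ, ZMod.stdAddChar ((u : ZMod n) * (a : ZMod n)) with hS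
  have hre : ramanujanSum n a = S.re := by
    rw [hS, sum_units_eq n fun z => ZMod.stdAddChar (z * (a : ZMod n)), Complex.re_sum,
      ramanujanSum]
    exact Finset.sum_congr rfl fun h _ => cos_eq_re_stdAddChar n h a
  -- The substitution `u ↦ -u` conjugates the sum, which is therefore real.
  have hconj : (starRingEnd ℂ) S = S := by
    rw [hS, map_sum]
    refine Fintype.sum_equiv (Equiv.neg _) _ _ fun u => ?_
    rw [← AddChar.map_neg_eq_conj, Equiv.neg_apply, Units.val_neg, neg_mul]
  rw [hre]
  exact Complex.conj_eq_iff_re.1 hconj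

lemma norm_ramanujanSum_le (n : ℕ) (a : ℕ) : ‖(ramanujanSum n a : ℂ)‖ ≤ n := by
  rw [Complex.norm_real, ramanujanSum]
  refine (norm_sum_le_of_le _ fun h _ => Real.abs_cos_le_one _).trans ?_
  rw [Finset.sum_const, nsmul_eq_mul, mul_one]
  exact_mod_cast (Finset.card_filter_le _ _).trans (by simp)

/-- The additive character modulo `g * m` at a multiple of `g` is the one modulo `m`. -/
lemma stdAddChar_mul_natCast {n m g : ℕ} [NeZero n] [NeZero m] (h : n = g * m) (z : ZMod n) :
    ZMod.stdAddChar (z * (g : ZMod n))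
      = ZMod.stdAddChar (ZMod.castHom (Dvd.intro_left g h.symm) (ZMod m) z) := by
  obtain ⟨k, rfl⟩ := ZMod.intCast_surjective z
  have hm : (m : ℂ) ≠ 0 := by exact_mod_cast NeZero.ne m
  have hg : (g : ℂ) ≠ 0 := by
    have : g ≠ 0 := by
      rintro rfl
      exact NeZero.ne n (by rw [h, zero_mul])
    exact_mod_cast this
  have h1 : ((k : ZMod n) * (g : ZMod n)) = ((k * g : ℤ) : ZMod n) := by push_cast; rfl
  rw [h1, map_intCast (ZMod.castHom _ (ZMod m)), ZMod.stdAddChar_coe, ZMod.stdAddChar_coe]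
  congr 1
  rw [h]
  push_cast
  field_simp

lemma sum_stdAddChar_mul (m : ℕ) [NeZero m] (a : ℕ) :
    ∑ k ∈ Finset.Icc 1 m, ZMod.stdAddChar ((k : ZMod m) * (a : ZMod m))
      = if m ∣ a then (m : ℂ) else 0 := by
  rw [sum_Icc_natCast_zmod m fun z => ZMod.stdAddChar (z * (a : ZMod m)),
    AddChar.sum_mulShift _ (ZMod.isPrimitive_stdAddChar m), ZMod.card]
  simp only [ZMod.natCast_eq_zero_iff]
  push_cast
  rfl

lemma sum_divisors_moebius_gcd {n : ℕ} (hn : n ≠ 0) (h : ℕ) :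
    (∑ d ∈ n.divisors, if d ∣ h then ((μ d : ℤ) : ℂ) else 0) = if Nat.Coprime h n then 1 else 0 := by
  have hg : Nat.gcd h n ≠ 0 := Nat.gcd_ne_zero_right hn
  have h1 : ∑ d ∈ (Nat.gcd h n).divisors, μ d = if Nat.gcd h n = 1 then 1 else 0 := by
    rw [← ArithmeticFunction.coe_mul_zeta_apply, ArithmeticFunction.moebius_mul_coe_zeta,
      ArithmeticFunction.one_apply]
  rw [← Finset.sum_filter]
  have h2 : n.divisors.filter (fun d => d ∣ h) = (Nat.gcd h n).divisors := by
    ext d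
    simp only [Finset.mem_filter, Nat.mem_divisors, Nat.dvd_gcd_iff]
    tauto
  rw [h2]
  have h3 := congrArg (fun z : ℤ => (z : ℂ)) h1
  push_cast at h3
  rw [h3]

/-- Kluyver's formula for the Ramanujan sum. -/
lemma ramanujanSum_eq_sum_divisors {n : ℕ} (hn : n ≠ 0) (a : ℕ) :
    (ramanujanSum n a : ℂ) =
      ∑ d ∈ n.divisors, if d ∣ a then (d : ℂ) * ((μ (n / d) : ℤ) : ℂ) else 0 := by
  have : NeZero n := ⟨hn⟩
  rw [ramanujanSum_eq_sum_units,
    sum_units_eq n fun z => ZMod.stdAddChar (z * (a : ZMod n)), Finset.sum_filter]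
  have h1 : ∀ h ∈ Finset.Icc 1 n, (if Nat.Coprime h n then
      ZMod.stdAddChar ((h : ZMod n) * (a : ZMod n)) else 0) = ∑ d ∈ n.divisors,
        if d ∣ h then ((μ d : ℤ) : ℂ) * ZMod.stdAddChar ((h : ZMod n) * (a : ZMod n)) else 0 := by
    intro h _
    have := congrArg (· * ZMod.stdAddChar ((h : ZMod n) * (a : ZMod n)))
      (sum_divisors_moebius_gcd hn h)
    simp only [Finset.sum_mul, ite_mul, one_mul, zero_mul] at this
    exact this.symm
  rw [Finset.sum_congr rfl h1, Finset.sum_comm,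
    ← Nat.sum_div_divisors n fun d => if d ∣ a then (d : ℂ) * ((μ (n / d) : ℤ) : ℂ) else 0]
  refine Finset.sum_congr rfl fun d hd => ?_
  rw [Nat.mem_divisors] at hd
  obtain ⟨⟨m, hm⟩, -⟩ := hd
  have hd0 : 0 < d := Nat.pos_of_ne_zero fun h => hn (by rw [hm, h, zero_mul])
  have hm0 : 0 < m := Nat.pos_of_ne_zero fun h => hn (by rw [hm, h, mul_zero])
  have : NeZero m := ⟨hm0.ne'⟩
  have hnd : n / d = m := by rw [hm, Nat.mul_div_cancel_left m hd0]
  have hnm : n / m = d := by rw [hm, Nat.mul_div_cancel d hm0]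
  have h2 : ∀ h ∈ Finset.Icc 1 n,
      (if d ∣ h then ((μ d : ℤ) : ℂ) * ZMod.stdAddChar ((h : ZMod n) * (a : ZMod n)) else 0)
      = if d ∣ h then (fun k : ℕ => ((μ d : ℤ) : ℂ) *
          ZMod.stdAddChar ((k : ZMod m) * (a : ZMod m))) (h / d) else 0 := by
    intro h _
    split_ifs with hdh
    · obtain ⟨k, rfl⟩ := hdh
      have := stdAddChar_mul_natCast hm ((k : ZMod n) * (a : ZMod n))
      rw [map_mul (ZMod.castHom _ (ZMod m)), map_natCast (ZMod.castHom _ (ZMod m)),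
        map_natCast (ZMod.castHom _ (ZMod m))] at this
      simp only [Nat.mul_div_cancel_left k hd0]
      rw [← this]
      push_cast
      congr 2
      ring
    · rfl
  rw [Finset.sum_congr rfl h2, sum_Icc_dilate (fun k : ℕ => ((μ d : ℤ) : ℂ) *
    ZMod.stdAddChar ((k : ZMod m) * (a : ZMod m))) hd0, hnd, hnm, ← Finset.mul_sum,
    sum_stdAddChar_mul]
  split_ifs <;> ring

lemma ramanujanSum_smoothPart {P n a : ℕ} (hn : n ∈ Nat.smoothNumbers (P + 1)) (ha : a ≠ 0) :
    (ramanujanSum n (smoothPart P a) : ℂ) = ramanujanSum n a := by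
  have hn0 := Nat.ne_zero_of_mem_smoothNumbers hn
  rw [ramanujanSum_eq_sum_divisors hn0, ramanujanSum_eq_sum_divisors hn0]
  refine Finset.sum_congr rfl fun d hd => ?_
  simp only [dvd_smoothPart_iff ha
    (Nat.mem_smoothNumbers_of_dvd hn (Nat.dvd_of_mem_divisors hd))]

/-- Reduction of units modulo a divisor `m` of `n` has fibres of equal size `φ(n) / φ(m)`. -/
lemma sum_units_comp_unitsMap {n m : ℕ} [NeZero n] [NeZero m] (h : m ∣ n) (f : (ZMod m)ˣ → ℂ) :
    ∑ u : (ZMod n)ˣ, f (ZMod.unitsMap h u)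
      = (Nat.totient n : ℂ) / (Nat.totient m : ℂ) * ∑ v : (ZMod m)ˣ, f v := by
  classical
  have hsurj := ZMod.unitsMap_surjective h
  set c := (Finset.univ.filter fun u : (ZMod n)ˣ => ZMod.unitsMap h u = 1).card with hc
  have hcard : ∀ v : (ZMod m)ˣ,
      (Finset.univ.filter fun u : (ZMod n)ˣ => ZMod.unitsMap h u = v).card = c := fun v =>
    MonoidHom.card_fiber_eq_of_mem_range (ZMod.unitsMap h) (hsurj v) (hsurj 1)
  have key : ∀ g : (ZMod m)ˣ → ℂ,
      ∑ u : (ZMod n)ˣ, g (ZMod.unitsMap h u) = (c : ℂ) * ∑ v : (ZMod m)ˣ, g v := by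
    intro g
    rw [← Finset.sum_fiberwise Finset.univ (ZMod.unitsMap h), Finset.mul_sum]
    refine Finset.sum_congr rfl fun v _ => ?_
    rw [Finset.sum_congr rfl fun u hu => by rw [(Finset.mem_filter.1 hu).2],
      Finset.sum_const, nsmul_eq_mul, hcard v]
  have h1 := key fun _ => 1
  simp only [Finset.sum_const, Finset.card_univ, ZMod.card_units_eq_totient, nsmul_eq_mul,
    mul_one] at h1
  have hm : (Nat.totient m : ℂ) ≠ 0 := by
    exact_mod_cast (Nat.totient_pos.2 (NeZero.pos m)).ne'
  rw [key f, h1, mul_div_cancel_right₀ _ hm]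

/-- Removing a factor `b` from the argument of a Ramanujan sum. -/
lemma ramanujanSum_mul {n b : ℕ} (hn : n ≠ 0) (s : ℕ) :
    (ramanujanSum n (b * s) : ℂ) = (Nat.totient n : ℂ) / (Nat.totient (n / n.gcd b) : ℂ) *
      ramanujanSum (n / n.gcd b) s := by
  have : NeZero n := ⟨hn⟩
  have hg0 : 0 < n.gcd b := Nat.gcd_pos_of_pos_left b (Nat.pos_of_ne_zero hn)
  have hnm : n = n.gcd b * (n / n.gcd b) := (Nat.mul_div_cancel' (Nat.gcd_dvd_left n b)).symm
  have hcop : Nat.Coprime (n / n.gcd b) (b / n.gcd b) := Nat.coprime_div_gcd_div_gcd hg0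
  have hb : b = n.gcd b * (b / n.gcd b) := (Nat.mul_div_cancel' (Nat.gcd_dvd_right n b)).symm
  set g := n.gcd b
  set m := n / g
  set b' := b / g
  have : NeZero m := ⟨fun h => hn (by rw [hnm, h, mul_zero])⟩
  have hmn : m ∣ n := Dvd.intro_left g hnm.symm
  rw [ramanujanSum_eq_sum_units, ramanujanSum_eq_sum_units]
  have h1 : ∀ u : (ZMod n)ˣ, ZMod.stdAddChar ((u : ZMod n) * ((b * s : ℕ) : ZMod n))
      = ZMod.stdAddChar (((ZMod.unitsMap hmn u : (ZMod m)ˣ) : ZMod m) *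
          ((b' : ZMod m) * (s : ZMod m))) := by
    intro u
    have := stdAddChar_mul_natCast hnm ((u : ZMod n) * ((b' : ZMod n) * (s : ZMod n)))
    rw [map_mul (ZMod.castHom _ (ZMod m)), map_mul (ZMod.castHom _ (ZMod m)),
      map_natCast (ZMod.castHom _ (ZMod m)), map_natCast (ZMod.castHom _ (ZMod m))] at this
    rw [ZMod.unitsMap_val, ← ZMod.castHom_apply (h := hmn), ← this, hb]
    push_cast
    congr 1
    ring
  rw [Finset.sum_congr rfl fun u _ => h1 u,
    sum_units_comp_unitsMap hmn fun v => ZMod.stdAddChar ((v : ZMod m) *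
          ((b' : ZMod m) * (s : ZMod m)))]
  congr 1
  refine Fintype.sum_equiv (Equiv.mulRight (ZMod.unitOfCoprime b' hcop.symm)) _ _ fun v => ?_
  rw [Equiv.coe_mulRight, Units.val_mul, ZMod.coe_unitOfCoprime, mul_assoc]

/-! ### Carmichael coefficients of exponentials -/

lemma expFun_eq (q : ℕ) [NeZero q] (j : ℤ) (a : ℕ) :
    expFun q j a = ZMod.stdAddChar ((j : ZMod q) * (a : ZMod q)) := by
  have : ((j : ZMod q) * (a : ZMod q)) = ((j * a : ℤ) : ZMod q) := by push_cast; rfl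
  rw [this, ZMod.stdAddChar_coe, expFun]
  congr 1
  push_cast
  ring

lemma norm_expFun (q : ℕ) [NeZero q] (j : ℤ) (a : ℕ) : ‖expFun q j a‖ = 1 := by
  rw [expFun_eq]
  exact AddChar.norm_apply _ _

lemma isUnit_intCast {q : ℕ} {j : ℤ} (hj : IsCoprime j (q : ℤ)) : IsUnit (j : ZMod q) := by
  obtain ⟨a, b, h⟩ := hj
  refine IsUnit.of_mul_eq_one (a : ZMod q) ?_
  have := congrArg (fun z : ℤ => (z : ZMod q)) h
  push_cast at this
  rw [ZMod.natCast_self, mul_zero, add_zero] at this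
  rw [mul_comm, this]

lemma eq_of_stdAddChar_mul_eq_one {q ℓ : ℕ} [NeZero q] [NeZero ℓ] {x : ZMod q} (hx : IsUnit x)
    (u : (ZMod ℓ)ˣ) (h : ZMod.stdAddChar x * ZMod.stdAddChar (u : ZMod ℓ) = 1) : ℓ = q := by
  have pow_q : (ZMod.stdAddChar x : ℂ) ^ q = 1 := by
    rw [← AddChar.map_nsmul_eq_pow, nsmul_eq_mul, ZMod.natCast_self, zero_mul,
      AddChar.map_zero_eq_one]
  have pow_l : (ZMod.stdAddChar (u : ZMod ℓ) : ℂ) ^ ℓ = 1 := by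
    rw [← AddChar.map_nsmul_eq_pow, nsmul_eq_mul, ZMod.natCast_self, zero_mul,
      AddChar.map_zero_eq_one]
  have key : ∀ {n : ℕ} [NeZero n] {z : ZMod n} {k : ℕ}, IsUnit z →
      (ZMod.stdAddChar z : ℂ) ^ k = 1 → n ∣ k := by
    intro n _ z k hz hk
    rw [← AddChar.map_nsmul_eq_pow, ← AddChar.map_zero_eq_one (ZMod.stdAddChar (N := n))] at hk
    have := ZMod.injective_stdAddChar hk
    rw [nsmul_eq_mul, hz.mul_left_eq_zero] at this
    exact (ZMod.natCast_eq_zero_iff k n).1 this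
  refine Nat.dvd_antisymm (key u.isUnit ?_) (key hx ?_)
  · have := congrArg (· ^ q) h
    simpa only [mul_pow, pow_q, one_mul, one_pow] using this
  · have := congrArg (· ^ ℓ) h
    simpa only [mul_pow, pow_l, mul_one, one_pow] using this

lemma hasMean_stdAddChar_mul {q ℓ : ℕ} [NeZero q] [NeZero ℓ] (x : ZMod q) (u : ZMod ℓ) :
    HasMean (fun a => ZMod.stdAddChar (x * (a : ZMod q)) * ZMod.stdAddChar (u * (a : ZMod ℓ)))
      (if (ZMod.stdAddChar x : ℂ) * ZMod.stdAddChar u = 1 then 1 else 0) := by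
  split_ifs with h
  · refine (hasMean_const 1).congr fun a _ => ?_
    rw [mul_comm x, mul_comm u, ← nsmul_eq_mul, ← nsmul_eq_mul, AddChar.map_nsmul_eq_pow,
      AddChar.map_nsmul_eq_pow, ← mul_pow, h, one_pow]
  · obtain ⟨M, hM⟩ := exists_hasMean_of_periodic (Nat.mul_pos (NeZero.pos q) (NeZero.pos ℓ))
      (f := fun a => ZMod.stdAddChar (x * (a : ZMod q)) * ZMod.stdAddChar (u * (a : ZMod ℓ)))
      (fun a => by push_cast; simp)
    have := hM.eq_zero_of_twist (N := 1) h fun a => by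
      push_cast
      rw [mul_add, mul_add, AddChar.map_add_eq_mul, AddChar.map_add_eq_mul, mul_one, mul_one]
      ring
    rwa [this] at hM

/-- `e_q(j a) c_ℓ(a)` has mean value `1` if `ℓ = q` and `0` otherwise. -/
lemma hasMean_expFun_mul_ramanujanSum {q ℓ : ℕ} [NeZero q] (hℓ : ℓ ≠ 0) {j : ℤ}
    (hj : IsCoprime j (q : ℤ)) :
    HasMean (fun a => expFun q j a * (ramanujanSum ℓ a : ℂ)) (if ℓ = q then 1 else 0) := by
  have : NeZero ℓ := ⟨hℓ⟩
  have hx := isUnit_intCast hj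
  have h1 := HasMean.sum Finset.univ fun (u : (ZMod ℓ)ˣ) _ =>
    hasMean_stdAddChar_mul (j : ZMod q) (u : ZMod ℓ)
  have h2 : ∑ u : (ZMod ℓ)ˣ, (if (ZMod.stdAddChar (j : ZMod q) : ℂ) *
      ZMod.stdAddChar (u : ZMod ℓ) = 1 then (1 : ℂ) else 0) = if ℓ = q then 1 else 0 := by
    split_ifs with h
    · subst h
      rw [Finset.sum_eq_single (-hx.unit), if_pos]
      · rw [← AddChar.map_add_eq_mul, Units.val_neg, IsUnit.unit_spec, add_neg_cancel,
          AddChar.map_zero_eq_one]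
      · intro u _ hu
        rw [if_neg]
        intro h
        rw [← AddChar.map_add_eq_mul,
          ← AddChar.map_zero_eq_one (ZMod.stdAddChar (N := ℓ))] at h
        have := ZMod.injective_stdAddChar h
        refine hu (Units.ext ?_)
        rw [Units.val_neg, IsUnit.unit_spec]
        exact eq_neg_of_add_eq_zero_right this
      · intro h
        exact absurd (Finset.mem_univ _) h
    · refine Finset.sum_eq_zero fun u _ => if_neg fun h' => h ?_
      exact eq_of_stdAddChar_mul_eq_one hx u h'
  rw [h2] at h1
  refine h1.congr fun a _ => ?_
  rw [expFun_eq, ramanujanSum_eq_sum_units, Finset.mul_sum]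

/-- If `ℓ` has a prime factor larger than `P`, then `c_ℓ` has mean value `0` over the integers
with a given `P`-smooth part: translation by `t ∏ p` preserves this set and multiplies
`e(u a / ℓ)` by a constant different from `1`. -/
lemma hasMean_ramanujanSum_smoothPart_eq {P ℓ t : ℕ} (hℓ : ℓ ≠ 0)
    (hℓP : ℓ ∉ Nat.smoothNumbers (P + 1)) (ht : t ∈ Nat.smoothNumbers (P + 1)) :
    HasMean (fun a => if smoothPart P a = t then (ramanujanSum ℓ a : ℂ) else 0) 0 := by
  have : NeZero ℓ := ⟨hℓ⟩
  set Q := t * ∏ p ∈ Nat.primesLE P, p with hQ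
  have hQmem : Q ∈ Nat.smoothNumbers (P + 1) :=
    Nat.mul_mem_smoothNumbers ht (prod_mem_smooth _ fun p hp =>
      prime_mem_smooth (Nat.prime_of_mem_primesLE hp) (Nat.le_of_mem_primesLE hp))
  have hQ0 : 0 < Q := Nat.pos_of_ne_zero (Nat.ne_zero_of_mem_smoothNumbers hQmem)
  have hu : ∀ u : (ZMod ℓ)ˣ, HasMean (fun a => if t ∣ a ∧ ∀ p ∈ Nat.primesLE P, ¬ t * p ∣ a then
      ZMod.stdAddChar ((u : ZMod ℓ) * (a : ZMod ℓ)) else 0) 0 := by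
    intro u
    obtain ⟨M, hM⟩ := exists_hasMean_of_periodic (Nat.mul_pos hQ0 (NeZero.pos ℓ))
      (f := fun a => if t ∣ a ∧ ∀ p ∈ Nat.primesLE P, ¬ t * p ∣ a then
        ZMod.stdAddChar ((u : ZMod ℓ) * (a : ZMod ℓ)) else 0) (fun a => by
        simp only [dvd_and_forall_not_dvd_add_iff (dvd_mul_right Q ℓ)]
        push_cast
        simp)
    have hζ : (ZMod.stdAddChar ((u : ZMod ℓ) * (Q : ZMod ℓ)) : ℂ) ≠ 1 := by
      rw [← AddChar.map_zero_eq_one (ZMod.stdAddChar (N := ℓ)),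
        ZMod.injective_stdAddChar.ne_iff, Ne, Units.mul_right_eq_zero,
        ZMod.natCast_eq_zero_iff]
      exact fun h => hℓP (Nat.mem_smoothNumbers_of_dvd hQmem h)
    have := hM.eq_zero_of_twist (N := Q) hζ fun a => by
      simp only [dvd_and_forall_not_dvd_add_iff (dvd_refl Q)]
      push_cast
      rw [mul_add, AddChar.map_add_eq_mul]
      split_ifs <;> ring
    rwa [this] at hM
  have h1 := HasMean.sum Finset.univ fun u (_ : u ∈ Finset.univ) => hu u
  rw [Finset.sum_const_zero] at h1
  refine h1.congr fun a ha => ?_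
  simp only [smoothPart_eq_iff (P := P) (a := a) (by lia) ht]
  split_ifs
  · rw [ramanujanSum_eq_sum_units]
  · exact Finset.sum_const_zero

/-! ### Expansion of exponentials in Dirichlet characters -/

lemma star_apply_of_isUnit {n : ℕ} [NeZero n] (χ : DirichletCharacter ℂ n) {m : ZMod n}
    (hm : IsUnit m) : (star χ) m = χ m⁻¹ := by
  rw [MulChar.star_eq_inv, MulChar.inv_apply_eq_inv']
  refine inv_eq_of_mul_eq_one_right ?_
  rw [← map_mul, ZMod.mul_inv_of_unit m hm, map_one]

lemma stdAddChar_eq_sum_characters {n : ℕ} [NeZero n] {z : ZMod n} (hz : IsUnit z) :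
    (ZMod.stdAddChar z : ℂ)
      = 1 / (Nat.totient n : ℂ) * ∑ χ : DirichletCharacter ℂ n, tau (star χ) * χ z := by
  have hφ : (Nat.totient n : ℂ) ≠ 0 := by
    exact_mod_cast (Nat.totient_pos.2 (NeZero.pos n)).ne'
  have h1 : ∑ χ : DirichletCharacter ℂ n, tau (star χ) * χ z
      = ∑ m : ZMod n, ZMod.stdAddChar m * ∑ χ : DirichletCharacter ℂ n, (star χ) m * χ z := by
    simp only [tau, gaussSum, Finset.sum_mul, Finset.mul_sum]
    rw [Finset.sum_comm]
    exact Finset.sum_congr rfl fun m _ => Finset.sum_congr rfl fun χ _ => by ring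
  have h2 : ∀ m : ZMod n, ∑ χ : DirichletCharacter ℂ n, (star χ) m * χ z
      = if m = z then (Nat.totient n : ℂ) else 0 := by
    intro m
    by_cases hm : IsUnit m
    · rw [← DirichletCharacter.sum_char_inv_mul_char_eq ℂ hm z]
      exact Finset.sum_congr rfl fun χ _ => by rw [star_apply_of_isUnit χ hm]
    · rw [if_neg (by rintro rfl; exact hm hz)]
      exact Finset.sum_eq_zero fun χ _ => by rw [MulChar.map_nonunit _ hm, zero_mul]
  rw [h1]
  simp only [h2, mul_ite, mul_zero, Finset.sum_ite_eq', Finset.mem_univ, if_true]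
  field_simp

lemma tau_one (n : ℕ) [NeZero n] {s : ℕ} (hs : Nat.Coprime s n) :
    tau (1 : DirichletCharacter ℂ n) = ramanujanSum n s := by
  classical
  rw [ramanujanSum_eq_sum_units, tau, gaussSum]
  have h1 : ∑ a : ZMod n, (1 : DirichletCharacter ℂ n) a * ZMod.stdAddChar a
      = ∑ u : (ZMod n)ˣ, (1 : DirichletCharacter ℂ n) u * ZMod.stdAddChar (u : ZMod n) := by
    rw [sum_units_eq n fun a => (1 : DirichletCharacter ℂ n) a * ZMod.stdAddChar a,
      ← sum_Icc_natCast_zmod, Finset.sum_filter]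
    refine Finset.sum_congr rfl fun h _ => ?_
    split_ifs with hh
    · rfl
    · rw [← ZMod.isUnit_iff_coprime] at hh
      rw [MulChar.map_nonunit _ hh, zero_mul]
  rw [h1]
  symm
  refine Fintype.sum_equiv (Equiv.mulRight (ZMod.unitOfCoprime s hs)) _ _ fun u => ?_
  rw [Equiv.coe_mulRight, MulChar.one_apply_coe, one_mul, Units.val_mul,
    ZMod.coe_unitOfCoprime]

/-- The contribution of the nonprincipal characters is the difference between an exponential and
its average over the units. -/
lemma sum_characters_ne_one {n : ℕ} [NeZero n] {j : ZMod n} (hj : IsUnit j) {s : ℕ}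
    (hs : Nat.Coprime s n) :
    1 / (Nat.totient n : ℂ) * ∑ χ : DirichletCharacter ℂ n with χ ≠ 1,
        tau (star χ) * χ j * χ (s : ZMod n)
      = ZMod.stdAddChar (j * (s : ZMod n)) - (ramanujanSum n s : ℂ) / (Nat.totient n : ℂ) := by
  have hu : IsUnit (j * (s : ZMod n)) := hj.mul ((ZMod.isUnit_iff_coprime s n).2 hs)
  rw [stdAddChar_eq_sum_characters hu,
    ← Finset.sum_filter_add_sum_filter_not Finset.univ fun χ : DirichletCharacter ℂ n => χ ≠ 1]
  have h1 : (Finset.univ.filter fun χ : DirichletCharacter ℂ n => ¬ χ ≠ 1) = {1} := by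
    ext χ
    simp
  rw [h1, Finset.sum_singleton, star_one, tau_one n hs, MulChar.one_apply hu, mul_one]
  simp only [map_mul, mul_assoc]
  ring

lemma coprime_div_gcd {q t : ℕ} (hq : q ≠ 0) :
    Nat.Coprime (t / q.gcd t) (q / q.gcd t) :=
  (Nat.coprime_div_gcd_div_gcd (Nat.gcd_pos_of_pos_left t (Nat.pos_of_ne_zero hq))).symm

/-- The nonprincipal part of `e_q(j t)`: only the divisor `b = (q, t)` contributes, as otherwise
`t / b` is not coprime to `q / b`. -/
lemma expFun_sub_eq_sum {q : ℕ} [NeZero q] {j : ℤ} (hj : IsCoprime j (q : ℤ)) (t : ℕ) :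
    expFun q j t - (ramanujanSum q t : ℂ) / (Nat.totient q : ℂ) =
      ∑ b : q.divisors, if (b : ℕ) ∣ t then
        1 / (Nat.totient (q / (b : ℕ)) : ℂ) *
          ∑ χ : DirichletCharacter ℂ (q / (b : ℕ)) with χ ≠ 1,
            tau (star χ) * χ (j : ZMod (q / (b : ℕ))) * χ ((t / (b : ℕ) : ℕ) : ZMod (q / (b : ℕ)))
        else 0 := by
  have hq : q ≠ 0 := NeZero.ne q
  have hφ : ∀ n : ℕ, n ≠ 0 → (Nat.totient n : ℂ) ≠ 0 := fun n hn => by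
    exact_mod_cast (Nat.totient_pos.2 (Nat.pos_of_ne_zero hn)).ne'
  rw [Finset.sum_eq_single
    (⟨q.gcd t, Nat.mem_divisors.2 ⟨Nat.gcd_dvd_left q t, hq⟩⟩ : q.divisors)]
  · rw [if_pos (Nat.gcd_dvd_right q t)]
    have hcop := coprime_div_gcd (t := t) hq
    have hqb : q = q.gcd t * (q / q.gcd t) := (Nat.mul_div_cancel' (Nat.gcd_dvd_left q t)).symm
    have htb : t = q.gcd t * (t / q.gcd t) := (Nat.mul_div_cancel' (Nat.gcd_dvd_right q t)).symm
    have hgg : q.gcd (q.gcd t) = q.gcd t := Nat.gcd_eq_right (Nat.gcd_dvd_left q t)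
    have hram := ramanujanSum_mul (b := q.gcd t) hq (t / q.gcd t)
    rw [← htb, hgg] at hram
    have hdvd : q / q.gcd t ∣ q := Nat.div_dvd_of_dvd (Nat.gcd_dvd_left q t)
    have : NeZero (q / q.gcd t) := ⟨fun h => hq (by rw [hqb, h, mul_zero])⟩
    have hj' : IsUnit (j : ZMod (q / q.gcd t)) :=
      isUnit_intCast (hj.of_isCoprime_of_dvd_right (by exact_mod_cast hdvd))
    have hexp := stdAddChar_mul_natCast hqb ((j : ZMod q) * ((t / q.gcd t : ℕ) : ZMod q))
    rw [map_mul (ZMod.castHom _ (ZMod (q / q.gcd t))),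
      map_natCast (ZMod.castHom _ (ZMod (q / q.gcd t))),
      map_intCast (ZMod.castHom _ (ZMod (q / q.gcd t)))] at hexp
    have hcast : (j : ZMod q) * (t : ZMod q)
        = (j : ZMod q) * ((t / q.gcd t : ℕ) : ZMod q) * (q.gcd t : ZMod q) := by
      rw [mul_assoc, ← Nat.cast_mul, mul_comm (t / q.gcd t), ← htb]
    have h1 := hφ q hq
    have h2 := hφ (q / q.gcd t) (NeZero.ne _)
    have hmain := sum_characters_ne_one hj' hcop
    rw [expFun_eq, hcast, hexp, hram]
    refine Eq.trans ?_ hmain.symm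
    field_simp
  · rintro ⟨b, hb⟩ - hne
    rw [Nat.mem_divisors] at hb
    split_ifs with hbt
    · have hbg : b ∣ q.gcd t := Nat.dvd_gcd hb.1 hbt
      have hcop : ¬ Nat.Coprime (t / b) (q / b) := by
        intro h
        apply hne
        have h1 : Nat.gcd (q / b) (t / b) = q.gcd t / b := Nat.gcd_div hb.1 hbt
        rw [Nat.coprime_comm, Nat.Coprime, h1] at h
        exact Subtype.ext ((Nat.eq_of_dvd_of_div_eq_one hbg h))
      rw [Finset.sum_eq_zero, mul_zero]
      intro χ _
      rw [MulChar.map_nonunit χ (fun h => hcop ((ZMod.isUnit_iff_coprime _ _).1 h)), mul_zero]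
    · rfl
  · intro h
    exact absurd (Finset.mem_univ _) h

/-! ### The local factor of a character -/

lemma sum_moebius_char_prime_pow {n : ℕ} [NeZero n] (χ : DirichletCharacter ℂ n) {p k : ℕ}
    (hp : p.Prime) (hk : 0 < k) :
    ∑ d ∈ (p ^ k).divisors, ((μ (p ^ k / d) : ℤ) : ℂ) * χ (d : ZMod n)
      = χ (p : ZMod n) ^ k - χ (p : ZMod n) ^ (k - 1) := by
  obtain ⟨k, rfl⟩ := Nat.exists_eq_add_of_lt hk
  rw [zero_add, Nat.divisors_prime_pow hp, Finset.sum_map, Finset.sum_range_succ,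
    Finset.sum_range_succ, Finset.sum_eq_zero]
  · have h1 : p ^ (k + 1) / p ^ k = p := by
      rw [pow_succ, Nat.mul_div_cancel_left _ (pow_pos hp.pos k)]
    have h2 : p ^ (k + 1) / p ^ (k + 1) = 1 := Nat.div_self (pow_pos hp.pos _)
    simp only [Function.Embedding.coeFn_mk, h1, h2, ArithmeticFunction.moebius_apply_prime hp,
      ArithmeticFunction.moebius_apply_one, Nat.cast_pow, map_pow, Nat.add_sub_cancel]
    push_cast
    ring
  · intro i hi
    rw [Finset.mem_range] at hi
    simp only [Function.Embedding.coeFn_mk]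
    rw [Nat.pow_div (by lia) hp.pos, ArithmeticFunction.moebius_eq_zero_of_not_squarefree,
      Int.cast_zero, zero_mul]
    rw [Nat.squarefree_pow_iff hp.ne_one (by lia)]
    lia

lemma sum_moebius_char_mul {n : ℕ} (χ : DirichletCharacter ℂ n) {a b : ℕ} (hab : a.Coprime b) :
    ∑ d ∈ (a * b).divisors, ((μ (a * b / d) : ℤ) : ℂ) * χ (d : ZMod n)
      = (∑ d ∈ a.divisors, ((μ (a / d) : ℤ) : ℂ) * χ (d : ZMod n)) *
        ∑ d ∈ b.divisors, ((μ (b / d) : ℤ) : ℂ) * χ (d : ZMod n) := by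
  have hmult := χ.isMultiplicative_toArithmeticFunction.mul
    (ArithmeticFunction.isMultiplicative_moebius.intCast (R := ℂ))
  have h1 : ∀ m : ℕ, ∑ d ∈ m.divisors, ((μ (m / d) : ℤ) : ℂ) * χ (d : ZMod n)
      = (toArithmeticFunction (fun k => χ (k : ZMod n)) *
          ((μ : ArithmeticFunction ℤ) : ArithmeticFunction ℂ)) m := by
    intro m
    rw [ArithmeticFunction.mul_apply,
      Nat.sum_divisorsAntidiagonal fun x y => toArithmeticFunction (fun k => χ (k : ZMod n)) x *
        ((μ : ArithmeticFunction ℤ) : ArithmeticFunction ℂ) y]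
    refine Finset.sum_congr rfl fun d hd => ?_
    rw [← χ.apply_eq_toArithmeticFunction_apply (Nat.pos_of_mem_divisors hd).ne',
      ArithmeticFunction.intCoe_apply, mul_comm]
  rw [h1, h1, h1, hmult.map_mul_of_coprime hab]

/-- The divisor sum `∑ μ(m / d) χ(d)` in closed form. Both sides are multiplicative in `m`; at a
power of a prime dividing the modulus only `d = 1` contributes. -/
lemma sum_moebius_char {n : ℕ} [NeZero n] (χ : DirichletCharacter ℂ n) {m : ℕ} (hm : m ≠ 0) :
    ∑ d ∈ m.divisors, ((μ (m / d) : ℤ) : ℂ) * χ (d : ZMod n)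
      = ((μ (m.gcd n) : ℤ) : ℂ) * χ ((m / m.gcd n : ℕ) : ZMod n) *
        ∏ p ∈ (m / m.gcd n).primeFactors, (1 - (star χ) (p : ZMod n)) := by
  induction m using Nat.recOnPosPrimePosCoprime with
  | zero => exact absurd rfl hm
  | one => simp
  | prime_pow p k hp hk =>
    rw [sum_moebius_char_prime_pow χ hp hk]
    by_cases hpn : p ∣ n
    · have hχ : χ (p : ZMod n) = 0 := by
        refine MulChar.map_nonunit χ fun h => ?_
        rw [ZMod.isUnit_iff_coprime, hp.coprime_iff_not_dvd] at h
        exact h hpn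
      obtain ⟨i, hik, hi⟩ := (Nat.dvd_prime_pow hp).1 (Nat.gcd_dvd_left (p ^ k) n)
      have hi0 : i ≠ 0 := by
        rintro rfl
        have h1 : p ∣ (p ^ k).gcd n := Nat.dvd_gcd (dvd_pow_self p hk.ne') hpn
        rw [hi, pow_zero] at h1
        exact hp.one_lt.ne' (Nat.dvd_one.1 h1)
      rw [hi, Nat.pow_div hik hp.pos, Nat.cast_pow, map_pow χ, hχ, zero_pow hk.ne', zero_sub]
      by_cases hi1 : i = 1
      · rw [hi1, pow_one, ArithmeticFunction.moebius_apply_prime hp]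
        by_cases hk1 : k = 1
        · simp [hk1]
        · rw [zero_pow (by lia)]
          simp
      · rw [ArithmeticFunction.moebius_eq_zero_of_not_squarefree, zero_pow (by lia)]
        · simp
        · rw [Nat.squarefree_pow_iff hp.ne_one hi0]
          lia
    · have hcop : p.Coprime n := hp.coprime_iff_not_dvd.2 hpn
      have hu : IsUnit (p : ZMod n) := (ZMod.isUnit_iff_coprime p n).2 hcop
      have h1 : χ (p : ZMod n) * (star χ) (p : ZMod n) = 1 := by
        rw [star_apply_of_isUnit χ hu, ← map_mul, ZMod.mul_inv_of_unit _ hu, map_one]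
      have hg : (p ^ k).gcd n = 1 := hcop.pow_left k
      obtain ⟨k, rfl⟩ := Nat.exists_eq_add_of_lt hk
      rw [hg, Nat.div_one, Nat.primeFactors_pow _ hk.ne', hp.primeFactors,
        Finset.prod_singleton, ArithmeticFunction.moebius_apply_one, Nat.cast_pow, map_pow,
        zero_add, Nat.add_sub_cancel]
      push_cast
      linear_combination (χ (p : ZMod n)) ^ k * h1
  | coprime a b ha hb hab iha ihb =>
    have ha0 : a ≠ 0 := by lia
    have hb0 : b ≠ 0 := by lia
    have hga : a.gcd n ∣ a := Nat.gcd_dvd_left a n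
    have hgb : b.gcd n ∣ b := Nat.gcd_dvd_left b n
    have hgcd : (a * b).gcd n = a.gcd n * b.gcd n := hab.mul_gcd n
    have hcopg : (a.gcd n).Coprime (b.gcd n) := (hab.coprime_dvd_left hga).coprime_dvd_right hgb
    have hdiv : a * b / (a.gcd n * b.gcd n) = (a / a.gcd n) * (b / b.gcd n) :=
      Nat.mul_div_mul_comm hga hgb
    have hcopd : (a / a.gcd n).Coprime (b / b.gcd n) :=
      (hab.coprime_dvd_left (Nat.div_dvd_of_dvd hga)).coprime_dvd_right (Nat.div_dvd_of_dvd hgb)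
    rw [sum_moebius_char_mul χ hab, iha ha0, ihb hb0, hgcd, hdiv,
      ArithmeticFunction.isMultiplicative_moebius.map_mul_of_coprime hcopg,
      hcopd.primeFactors_mul, Finset.prod_union hcopd.disjoint_primeFactors]
    push_cast
    rw [map_mul]
    ring

/-! ### The explicit formula -/

lemma hasSmoothSum_char (P : ℕ) {n : ℕ} (χ : DirichletCharacter ℂ n) :
    HasSmoothSum P (fun t => χ (t : ZMod n)) (eulerProd (fun p => χ (p : ZMod n)) P) :=
  hasSmoothSum_eulerProd P
    { toFun := fun t => χ (t : ZMod n)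
      map_one' := by simp
      map_mul' := fun a b => by simp } fun t => χ.norm_le_one t

lemma hasSmoothSum_char_mul_ramanujanSum {P n m : ℕ} (χ : DirichletCharacter ℂ n)
    (hm : m ∈ Nat.smoothNumbers (P + 1)) :
    HasSmoothSum P (fun s => χ (s : ZMod n) * (ramanujanSum m s : ℂ))
      ((∑ d ∈ m.divisors, ((μ (m / d) : ℤ) : ℂ) * χ (d : ZMod n)) *
        eulerProd (fun p => χ (p : ZMod n)) P) := by
  have h1 := HasSmoothSum.sum m.divisors fun d (hd : d ∈ m.divisors) =>
    (((hasSmoothSum_char P χ).dilate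
      (Nat.mem_smoothNumbers_of_dvd hm (Nat.dvd_of_mem_divisors hd))).const_mul
        ((d : ℂ) * ((μ (m / d) : ℤ) : ℂ) * χ (d : ZMod n)))
  have h2 : ∑ d ∈ m.divisors, (d : ℂ) * ((μ (m / d) : ℤ) : ℂ) * χ (d : ZMod n) *
      (eulerProd (fun p => χ (p : ZMod n)) P / d)
      = (∑ d ∈ m.divisors, ((μ (m / d) : ℤ) : ℂ) * χ (d : ZMod n)) *
        eulerProd (fun p => χ (p : ZMod n)) P := by
    rw [Finset.sum_mul]
    refine Finset.sum_congr rfl fun d hd => ?_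
    have : (d : ℂ) ≠ 0 := by exact_mod_cast (Nat.pos_of_mem_divisors hd).ne'
    field_simp
  rw [h2] at h1
  refine h1.congr fun s _ => ?_
  rw [ramanujanSum_eq_sum_divisors (Nat.ne_zero_of_mem_smoothNumbers hm), Finset.mul_sum]
  refine Finset.sum_congr rfl fun d hd => ?_
  split_ifs with hds
  · obtain ⟨k, rfl⟩ := hds
    rw [Nat.mul_div_cancel_left k (Nat.pos_of_mem_divisors hd)]
    push_cast
    rw [map_mul]
    ring
  · ring

/-- The smooth sum attached to a divisor `b` of `q` and a character, in the shape of the explicit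
formula. -/
lemma hasSmoothSum_dilate_char_mul_ramanujanSum {P n b ℓ : ℕ} [NeZero n]
    (χ : DirichletCharacter ℂ n) (hb : b ∈ Nat.smoothNumbers (P + 1))
    (hℓ : ℓ ∈ Nat.smoothNumbers (P + 1)) (j : ℤ) :
    HasSmoothSum P (fun t => (if b ∣ t then tau (star χ) * χ (j : ZMod n) *
        χ ((t / b : ℕ) : ZMod n) else 0) * (ramanujanSum ℓ t : ℂ))
      ((Nat.totient ℓ : ℂ) * eulerProd (fun _ => 1) P *
        (1 / (b : ℂ) * charTerm χ j P (ℓ / ℓ.gcd b))) := by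
  have hℓ0 := Nat.ne_zero_of_mem_smoothNumbers hℓ
  have hb0 := Nat.ne_zero_of_mem_smoothNumbers hb
  have hdvd : ℓ / ℓ.gcd b ∣ ℓ := Nat.div_dvd_of_dvd (Nat.gcd_dvd_left ℓ b)
  have hmem := Nat.mem_smoothNumbers_of_dvd hℓ hdvd
  have h1 := ((hasSmoothSum_char_mul_ramanujanSum χ hmem).dilate hb).const_mul
    (tau (star χ) * χ (j : ZMod n) *
      ((Nat.totient ℓ : ℂ) / (Nat.totient (ℓ / ℓ.gcd b) : ℂ)))
  rw [sum_moebius_char χ (Nat.ne_zero_of_mem_smoothNumbers hmem)] at h1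
  have hE := eulerProd_one_ne_zero P
  refine HasSmoothSum.congr (f := fun t => tau (star χ) * χ (j : ZMod n) *
      ((Nat.totient ℓ : ℂ) / (Nat.totient (ℓ / ℓ.gcd b) : ℂ)) * (if b ∣ t then
        χ ((t / b : ℕ) : ZMod n) * (ramanujanSum (ℓ / ℓ.gcd b) (t / b) : ℂ) else 0)) ?_ ?_
  · convert h1 using 1
    unfold charTerm
    field_simp
  · intro t _
    split_ifs with hbt
    · obtain ⟨s, rfl⟩ := hbt
      rw [Nat.mul_div_cancel_left s (Nat.pos_of_ne_zero hb0), ramanujanSum_mul hℓ0 s]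
      ring
    · ring

/-- The right-hand side of the explicit formula: the difference `Car^(P) - Car`. -/
noncomputable def formulaSum (q : ℕ) [NeZero q] (j : ℤ) (P ℓ : ℕ) : ℂ :=
  ∑ b : q.divisors,
    1 / (((b : ℕ) : ℂ) * (Nat.totient (q / (b : ℕ)) : ℂ)) *
      ∑ χ : DirichletCharacter ℂ (q / (b : ℕ)) with χ ≠ 1,
        charTerm χ j P (ℓ / Nat.gcd ℓ (b : ℕ))

lemma hasSmoothSum_expFun_sub {q P ℓ : ℕ} [NeZero q] {j : ℤ} (hj : IsCoprime j (q : ℤ))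
    (hqP : q ≤ P) (hℓ : ℓ ∈ Nat.smoothNumbers (P + 1)) :
    HasSmoothSum P (fun t => (expFun q j t - (ramanujanSum q t : ℂ) / (Nat.totient q : ℂ)) *
        (ramanujanSum ℓ t : ℂ))
      ((Nat.totient ℓ : ℂ) * eulerProd (fun _ => 1) P * formulaSum q j P ℓ) := by
  have hb : ∀ b : q.divisors, (b : ℕ) ∈ Nat.smoothNumbers (P + 1) := fun b =>
    Nat.mem_smoothNumbers_of_lt (Nat.pos_of_mem_divisors b.2)
      (Nat.lt_succ_of_le ((Nat.divisor_le b.2).trans hqP))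
  have h1 := HasSmoothSum.sum Finset.univ fun (b : q.divisors) _ =>
    (HasSmoothSum.sum (Finset.univ.filter fun χ : DirichletCharacter ℂ (q / (b : ℕ)) => χ ≠ 1)
      fun χ _ => hasSmoothSum_dilate_char_mul_ramanujanSum χ (hb b) hℓ j).const_mul
        (1 / (Nat.totient (q / (b : ℕ)) : ℂ))
  have h2 : ∑ b : q.divisors, 1 / (Nat.totient (q / (b : ℕ)) : ℂ) *
      ∑ χ : DirichletCharacter ℂ (q / (b : ℕ)) with χ ≠ 1,
        (Nat.totient ℓ : ℂ) * eulerProd (fun _ => 1) P *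
        (1 / ((b : ℕ) : ℂ) * charTerm χ j P (ℓ / ℓ.gcd b))
      = (Nat.totient ℓ : ℂ) * eulerProd (fun _ => 1) P * formulaSum q j P ℓ := by
    rw [formulaSum, Finset.mul_sum]
    refine Finset.sum_congr rfl fun b _ => ?_
    rw [← Finset.mul_sum, ← Finset.mul_sum]
    ring
  rw [h2] at h1
  refine h1.congr fun t _ => ?_
  rw [expFun_sub_eq_sum hj, Finset.sum_mul]
  refine Finset.sum_congr rfl fun b _ => ?_
  split_ifs
  · rw [← Finset.sum_mul, mul_assoc]
  · simp

lemma hasMean_ramanujanSum_mul {q ℓ : ℕ} [NeZero q] (hℓ : ℓ ≠ 0) :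
    HasMean (fun a => (ramanujanSum q a : ℂ) * (ramanujanSum ℓ a : ℂ))
      ((Nat.totient q : ℂ) * if ℓ = q then 1 else 0) := by
  have hu : ∀ u : (ZMod q)ˣ, IsCoprime (((u : ZMod q).val : ℕ) : ℤ) (q : ℤ) := fun u =>
    Nat.isCoprime_iff_coprime.2 (ZMod.val_coe_unit_coprime u)
  have h1 := HasMean.sum Finset.univ fun (u : (ZMod q)ˣ) _ =>
    hasMean_expFun_mul_ramanujanSum hℓ (hu u)
  rw [Finset.sum_const, Finset.card_univ, ZMod.card_units_eq_totient, nsmul_eq_mul] at h1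
  refine h1.congr fun a _ => ?_
  rw [ramanujanSum_eq_sum_units q, Finset.sum_mul]
  refine Finset.sum_congr rfl fun u _ => ?_
  rw [expFun_eq, Int.cast_natCast, ZMod.natCast_zmod_val]

/-- The mean value behind the explicit formula. The average `c_q / φ(q)` of the exponentials over
the units is unaffected by passing to the smooth part, so it gives the main term; the difference
is a combination of nonprincipal characters. -/
lemma hasMean_smoothRestriction_of_mem {q P ℓ : ℕ} [NeZero q] {j : ℤ}
    (hj : IsCoprime j (q : ℤ)) (hqP : q ≤ P) (hℓ : ℓ ∈ Nat.smoothNumbers (P + 1)) :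
    HasMean (fun a => smoothRestriction P (expFun q j) a * (ramanujanSum ℓ a : ℂ))
      ((Nat.totient ℓ : ℂ) * formulaSum q j P ℓ + if ℓ = q then 1 else 0) := by
  have hℓ0 := Nat.ne_zero_of_mem_smoothNumbers hℓ
  have hq : q ∈ Nat.smoothNumbers (P + 1) :=
    Nat.mem_smoothNumbers_of_lt (NeZero.pos q) (by lia)
  have hφ : (Nat.totient q : ℂ) ≠ 0 := by
    exact_mod_cast (Nat.totient_pos.2 (NeZero.pos q)).ne'
  have hbound : ∀ t, ‖(expFun q j t - (ramanujanSum q t : ℂ) / (Nat.totient q : ℂ)) *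
      (ramanujanSum ℓ t : ℂ)‖ ≤ (1 + q / Nat.totient q) * ℓ := by
    intro t
    rw [norm_mul]
    refine mul_le_mul ((norm_sub_le _ _).trans (add_le_add (norm_expFun q j t).le ?_))
      (norm_ramanujanSum_le ℓ t) (norm_nonneg _) (by positivity)
    rw [norm_div, Complex.norm_natCast]
    gcongr
    exact norm_ramanujanSum_le q t
  have h1 := hasMean_comp_smoothPart hbound (hasSmoothSum_expFun_sub hj hqP hℓ)
  have h2 := (hasMean_ramanujanSum_mul (q := q) hℓ0).const_mul (1 / (Nat.totient q : ℂ))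
  have h3 := h1.add h2
  have hE := eulerProd_one_ne_zero P
  have h4 : (Nat.totient ℓ : ℂ) * eulerProd (fun _ => 1) P * formulaSum q j P ℓ /
      eulerProd (fun _ => 1) P + 1 / (Nat.totient q : ℂ) * ((Nat.totient q : ℂ) *
        if ℓ = q then 1 else 0) = (Nat.totient ℓ : ℂ) * formulaSum q j P ℓ +
          if ℓ = q then 1 else 0 := by
    field_simp
  rw [h4] at h3
  refine h3.congr fun a ha => ?_
  have ha0 : a ≠ 0 := by lia
  rw [smoothRestriction_eq P _ ha0, ramanujanSum_smoothPart hq ha0,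
    ramanujanSum_smoothPart hℓ ha0]
  ring

lemma hasMean_smoothRestriction_of_notMem {q P ℓ : ℕ} [NeZero q] {j : ℤ} (hℓ0 : ℓ ≠ 0)
    (hℓ : ℓ ∉ Nat.smoothNumbers (P + 1)) :
    HasMean (fun a => smoothRestriction P (expFun q j) a * (ramanujanSum ℓ a : ℂ)) 0 := by
  have h1 := hasMean_smoothPart (F := expFun q j) (fun a => (norm_expFun q j a).le)
    (norm_ramanujanSum_le ℓ) fun t ht => hasMean_ramanujanSum_smoothPart_eq hℓ0 hℓ ht
  simp only [mul_zero, Set.indicator_zero, tsum_zero] at h1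
  refine h1.congr fun a ha => ?_
  rw [smoothRestriction_eq P _ (by lia : a ≠ 0)]

lemma car_expFun {q ℓ : ℕ} [NeZero q] (hℓ : ℓ ≠ 0) {j : ℤ} (hj : IsCoprime j (q : ℤ)) :
    car (expFun q j) ℓ = if ℓ = q then 1 / (Nat.totient q : ℂ) else 0 := by
  rw [car_eq_of_hasMean (hasMean_expFun_mul_ramanujanSum hℓ hj)]
  split_ifs with h
  · rw [h, mul_one]
  · rw [mul_zero]

lemma smoothCar_expFun_of_mem {q P ℓ : ℕ} [NeZero q] {j : ℤ} (hj : IsCoprime j (q : ℤ))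
    (hqP : q ≤ P) (hℓ : ℓ ∈ Nat.smoothNumbers (P + 1)) :
    smoothCar P (expFun q j) ℓ = car (expFun q j) ℓ + formulaSum q j P ℓ := by
  have hℓ0 := Nat.ne_zero_of_mem_smoothNumbers hℓ
  have hφ : (Nat.totient ℓ : ℂ) ≠ 0 := by
    exact_mod_cast (Nat.totient_pos.2 (Nat.pos_of_ne_zero hℓ0)).ne'
  rw [smoothCar, car_eq_of_hasMean (hasMean_smoothRestriction_of_mem hj hqP hℓ),
    car_eq_of_hasMean (hasMean_expFun_mul_ramanujanSum hℓ0 hj)]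
  field_simp
  ring

lemma smoothCar_expFun_of_notMem {q P ℓ : ℕ} [NeZero q] {j : ℤ} (hℓ0 : ℓ ≠ 0)
    (hℓ : ℓ ∉ Nat.smoothNumbers (P + 1)) : smoothCar P (expFun q j) ℓ = 0 := by
  rw [smoothCar, car_eq_of_hasMean (hasMean_smoothRestriction_of_notMem hℓ0 hℓ), mul_zero]

/-! ### Bounds for Euler products -/

/-- Mertens' upper bound: compare `∑ log p ⌊n / p⌋` with `log n!`. -/
lemma sum_log_div_le {n : ℕ} (hn : 1 ≤ n) :
    ∑ p ∈ Nat.primesLE n, Real.log p / p ≤ Real.log n + Real.log 4 := by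
  have hn0 : (0 : ℝ) < n := by exact_mod_cast hn
  have hθ : ∑ p ∈ Nat.primesLE n, Real.log p ≤ Real.log 4 * n := by
    rw [← Chebyshev.theta_eq_sum_primesLE_log]
    exact Chebyshev.theta_le_log4_mul_x hn0.le
  have hcount : ∀ p ∈ Nat.primesLE n, ((n / p : ℕ) : ℝ) * Real.log p
      = ∑ m ∈ Finset.Icc 1 n, if p ∣ m then Real.log p else 0 := by
    intro p _
    rw [← Finset.sum_filter, Finset.sum_const, nsmul_eq_mul, ← Nat.Ioc_filter_dvd_card_eq_div]
    rfl
  have hprod : ∀ m ∈ Finset.Icc 1 n,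
      ∑ p ∈ Nat.primesLE n, (if p ∣ m then Real.log p else 0) ≤ Real.log n := by
    intro m hm
    rw [Finset.mem_Icc] at hm
    have hsub : (Nat.primesLE n).filter (fun p => p ∣ m) ⊆ m.primeFactors := by
      intro p hp
      rw [Finset.mem_filter, Nat.mem_primesLE] at hp
      exact Nat.mem_primeFactors.2 ⟨hp.1.2, hp.2, by lia⟩
    rw [← Finset.sum_filter]
    calc ∑ p ∈ (Nat.primesLE n).filter (fun p => p ∣ m), Real.log p
        ≤ ∑ p ∈ m.primeFactors, Real.log p :=
          Finset.sum_le_sum_of_subset_of_nonneg hsub fun p _ _ => Real.log_natCast_nonneg p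
      _ = Real.log ((∏ p ∈ m.primeFactors, p : ℕ) : ℝ) := by
          rw [Nat.cast_prod, Real.log_prod]
          intro p hp
          exact_mod_cast (Nat.prime_of_mem_primeFactors hp).ne_zero
      _ ≤ Real.log n := by
          refine Real.log_le_log ?_ ?_
          · exact_mod_cast Finset.prod_pos fun p hp => (Nat.prime_of_mem_primeFactors hp).pos
          · exact_mod_cast (Nat.le_of_dvd (by lia) (Nat.prod_primeFactors_dvd m)).trans hm.2
  have hsum : ∑ p ∈ Nat.primesLE n, ((n / p : ℕ) : ℝ) * Real.log p ≤ n * Real.log n := by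
    rw [Finset.sum_congr rfl hcount, Finset.sum_comm]
    refine (Finset.sum_le_sum hprod).trans ?_
    rw [Finset.sum_const, Nat.card_Icc, nsmul_eq_mul, Nat.add_sub_cancel]
  have hterm : ∀ p ∈ Nat.primesLE n, n * (Real.log p / p)
      ≤ ((n / p : ℕ) : ℝ) * Real.log p + Real.log p := by
    intro p _
    have h1 : (n : ℝ) / p ≤ ((n / p : ℕ) : ℝ) + 1 := by
      rw [← Nat.floor_div_eq_div (K := ℝ)]
      exact (Nat.lt_floor_add_one _).le
    have h2 := mul_le_mul_of_nonneg_right h1 (Real.log_natCast_nonneg p)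
    calc n * (Real.log p / p) = n / p * Real.log p := by ring
      _ ≤ _ := h2
      _ = _ := by ring
  have h1 := Finset.sum_le_sum hterm
  rw [← Finset.mul_sum, Finset.sum_add_distrib] at h1
  have h2 : n * ∑ p ∈ Nat.primesLE n, Real.log p / p ≤ n * (Real.log n + Real.log 4) := by
    linarith
  exact le_of_mul_le_mul_left h2 hn0

lemma log_le_norm_eulerProd_one {P : ℕ} (hP : 1 ≤ P) :
    Real.log P ≤ ‖eulerProd (fun _ => 1) P‖ := by
  have h1 : Real.log P ≤ ∑ t ∈ Finset.Icc 1 P, 1 / (t : ℝ) := by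
    have h := log_add_one_le_harmonic P
    have h2 : Real.log P ≤ Real.log ((P + 1 : ℕ) : ℝ) :=
      Real.log_le_log (by exact_mod_cast hP) (by exact_mod_cast Nat.le_succ P)
    refine (h2.trans h).trans (le_of_eq ?_)
    rw [harmonic_eq_sum_Icc]
    push_cast
    simp
  have h2 : HasSum ((Nat.smoothNumbers (P + 1)).indicator fun t => 1 / (t : ℝ))
      (eulerProd (fun _ => 1) P).re := by
    refine (Complex.hasSum_re (hasSmoothSum_one P)).congr_fun fun t => ?_
    simp only [Set.indicator_apply]
    split_ifs
    · rw [← Complex.ofReal_natCast, ← Complex.ofReal_one, ← Complex.ofReal_div, Complex.ofReal_re]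
    · rfl
  have h3 := sum_le_hasSum (Finset.Icc 1 P) (fun t _ => Set.indicator_nonneg
    (fun t _ => by positivity) t) h2
  refine h1.trans (le_trans (le_of_eq ?_) (h3.trans (Complex.re_le_norm _)))
  refine Finset.sum_congr rfl fun t ht => ?_
  rw [Finset.mem_Icc] at ht
  rw [Set.indicator_of_mem (Nat.mem_smoothNumbers_of_lt (by lia) (by lia))]

lemma norm_one_sub_mul_le {z : ℂ} (hz : ‖z‖ ≤ 1) {x y : ℝ} (hyx : y ≤ x) (hx0 : 0 ≤ x)
    (hx : x ≤ 1 / 2) :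
    ‖1 - z * (y : ℂ)‖ ≤ ‖1 - z * (x : ℂ)‖ * Real.exp (2 * (x - y)) := by
  have h1 : 1 / 2 ≤ ‖1 - z * (x : ℂ)‖ := by
    have h2 := norm_sub_norm_le (1 : ℂ) (z * (x : ℂ))
    rw [norm_one, norm_mul, Complex.norm_real, Real.norm_eq_abs, abs_of_nonneg hx0] at h2
    nlinarith
  have h3 : ‖1 - z * (y : ℂ)‖ ≤ ‖1 - z * (x : ℂ)‖ + (x - y) := by
    have h4 : 1 - z * (y : ℂ) = (1 - z * (x : ℂ)) + z * ((x - y : ℝ) : ℂ) := by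
      push_cast
      ring
    rw [h4]
    refine (norm_add_le _ _).trans (add_le_add le_rfl ?_)
    rw [norm_mul, Complex.norm_real, Real.norm_eq_abs, abs_of_nonneg (by linarith)]
    nlinarith
  have h5 := Real.add_one_le_exp (2 * (x - y))
  nlinarith

lemma inv_sub_rpow_le {p : ℕ} (hp : 0 < p) (σ : ℝ) :
    1 / (p : ℝ) - (p : ℝ) ^ (-σ) ≤ (σ - 1) * (Real.log p / p) := by
  have hp0 : (0 : ℝ) < p := by exact_mod_cast hp
  have h1 : (p : ℝ) ^ (-σ) = 1 / (p : ℝ) * Real.exp (-((σ - 1) * Real.log p)) := by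
    rw [Real.rpow_def_of_pos hp0, one_div, ← Real.exp_log (inv_pos.2 hp0), ← Real.exp_add,
      Real.log_inv]
    congr 1
    ring
  have h2 := Real.add_one_le_exp (-((σ - 1) * Real.log p))
  rw [h1]
  have h3 := mul_le_mul_of_nonneg_left h2 (by positivity : (0 : ℝ) ≤ 1 / p)
  calc _ ≤ 1 / (p : ℝ) - 1 / (p : ℝ) * (-((σ - 1) * Real.log p) + 1) := by linarith
    _ = _ := by ring

lemma rpow_neg_le_inv {p : ℕ} (hp : 0 < p) {σ : ℝ} (hσ : 1 ≤ σ) : (p : ℝ) ^ (-σ) ≤ 1 / p := by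
  rw [one_div, ← Real.rpow_neg_one]
  exact Real.rpow_le_rpow_of_exponent_le (by exact_mod_cast hp) (by linarith)

/-- Moving the exponent from `1` to `1 + 1 / log P` changes an Euler product over `p ≤ P` by a
bounded factor. The constant is `exp (2 (1 + log 4 / log 2))`. -/
lemma norm_eulerProd_le {f : ℕ → ℂ} (hf : ∀ n, ‖f n‖ ≤ 1) {P : ℕ} (hP : 2 ≤ P) {σ : ℝ}
    (hσ : σ = 1 + 1 / Real.log P) :
    ‖eulerProd f P‖ ≤
      Real.exp 6 * ‖∏ p ∈ Nat.primesLE P, (1 - f p * (((p : ℝ) ^ (-σ) : ℝ) : ℂ))⁻¹‖ := by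
  have hlogP : Real.log 2 ≤ Real.log P := Real.log_le_log (by norm_num) (by exact_mod_cast hP)
  have hlog2 : 0 < Real.log 2 := Real.log_pos (by norm_num)
  have hlog : 0 < Real.log P := by linarith
  have hσ1 : 1 ≤ σ := by
    rw [hσ]
    have : 0 < 1 / Real.log P := by positivity
    linarith
  have hfac : ∀ p ∈ Nat.primesLE P, ‖(1 - f p / (p : ℂ))⁻¹‖ ≤
      Real.exp (2 * (1 / (p : ℝ) - (p : ℝ) ^ (-σ))) *
        ‖(1 - f p * (((p : ℝ) ^ (-σ) : ℝ) : ℂ))⁻¹‖ := by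
    intro p hp
    have hp2 : (2 : ℝ) ≤ p := by exact_mod_cast Nat.two_le_of_mem_primesLE hp
    have hpos : 0 < p := (Nat.prime_of_mem_primesLE hp).pos
    have hx : 1 / (p : ℝ) ≤ 1 / 2 := one_div_le_one_div_of_le (by norm_num) hp2
    have hy := rpow_neg_le_inv hpos hσ1
    have h1 := norm_one_sub_mul_le (hf p) hy (by positivity) hx
    have h2 : f p / (p : ℂ) = f p * ((1 / (p : ℝ) : ℝ) : ℂ) := by
      push_cast
      ring
    have h3 : 0 < ‖1 - f p * (((p : ℝ) ^ (-σ) : ℝ) : ℂ)‖ := by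
      rw [norm_pos_iff, sub_ne_zero]
      intro h
      have h4 := congrArg norm h
      rw [norm_one, norm_mul, Complex.norm_real, Real.norm_eq_abs,
        abs_of_nonneg (by positivity)] at h4
      have := hf p
      have : (0 : ℝ) ≤ (p : ℝ) ^ (-σ) := by positivity
      nlinarith
    rw [h2, norm_inv, norm_inv]
    have h5 : 0 < ‖1 - f p * ((1 / (p : ℝ) : ℝ) : ℂ)‖ := by
      by_contra h
      have h6 := le_antisymm (not_lt.1 h) (norm_nonneg _)
      rw [h6, zero_mul] at h1
      linarith
    rw [inv_le_iff_one_le_mul₀ h5, mul_assoc, ← div_eq_inv_mul, mul_div_assoc', one_le_div h3,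
      mul_comm (Real.exp _)]
    exact h1
  rw [eulerProd, norm_prod, norm_prod]
  refine (Finset.prod_le_prod (fun _ _ => norm_nonneg _) hfac).trans ?_
  rw [Finset.prod_mul_distrib, ← Real.exp_sum]
  refine mul_le_mul_of_nonneg_right (Real.exp_le_exp.2 ?_)
    (Finset.prod_nonneg fun _ _ => norm_nonneg _)
  rw [← Finset.mul_sum]
  have hsum : ∑ p ∈ Nat.primesLE P, (1 / (p : ℝ) - (p : ℝ) ^ (-σ)) ≤ 3 := by
    calc ∑ p ∈ Nat.primesLE P, (1 / (p : ℝ) - (p : ℝ) ^ (-σ))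
        ≤ ∑ p ∈ Nat.primesLE P, (σ - 1) * (Real.log p / p) :=
          Finset.sum_le_sum fun p hp => inv_sub_rpow_le (Nat.prime_of_mem_primesLE hp).pos σ
      _ = (1 / Real.log P) * ∑ p ∈ Nat.primesLE P, Real.log p / p := by
          rw [← Finset.mul_sum, hσ]
          ring
      _ ≤ (1 / Real.log P) * (Real.log P + Real.log 4) := by
          gcongr
          exact sum_log_div_le (by lia)
      _ ≤ 3 := by
          have h4 : Real.log 4 = 2 * Real.log 2 := by
            rw [show (4 : ℝ) = 2 ^ 2 by norm_num, Real.log_pow]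
            norm_num
          rw [one_div_mul_eq_div, div_le_iff₀ hlog]
          linarith
  linarith

/-- For `|z| ≤ 1` and `0 ≤ x < 1` the factor `|1 - z x|⁻¹ (1 - x)⁻¹` is at least `1`, so the product of the two
partial Euler products increases to its limit. -/
lemma norm_prod_mul_norm_prod_le {N : ℕ} (χ : DirichletCharacter ℂ N) {σ : ℝ} (hσ : 1 < σ)
    (P : ℕ) :
    ‖∏ p ∈ Nat.primesLE P, (1 - χ (p : ZMod N) * (((p : ℝ) ^ (-σ) : ℝ) : ℂ))⁻¹‖ *
      ‖∏ p ∈ Nat.primesLE P, (1 - 1 * (((p : ℝ) ^ (-σ) : ℝ) : ℂ))⁻¹‖ ≤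
      ‖LSeries (fun n => χ (n : ZMod N)) σ‖ * ‖riemannZeta σ‖ := by
  have hσ' : 1 < (σ : ℂ).re := by simpa using hσ
  have hcast : ∀ p : ℕ, (p : ℂ) ^ (-(σ : ℂ)) = (((p : ℝ) ^ (-σ) : ℝ) : ℂ) := by
    intro p
    rw [Complex.ofReal_cpow (Nat.cast_nonneg p)]
    push_cast
    rfl
  have h1 := (DirichletCharacter.LSeries_eulerProduct χ hσ').norm
  have h2 := (riemannZeta_eulerProduct hσ').norm
  simp only [hcast] at h1 h2
  have h3 := h1.mul h2
  have hmono : Monotone fun n : ℕ =>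
      ‖∏ p ∈ Nat.primesBelow n, (1 - χ (p : ZMod N) * (((p : ℝ) ^ (-σ) : ℝ) : ℂ))⁻¹‖ *
      ‖∏ p ∈ Nat.primesBelow n, (1 - (((p : ℝ) ^ (-σ) : ℝ) : ℂ))⁻¹‖ := by
    refine monotone_nat_of_le_succ fun n => ?_
    by_cases hn : n.Prime
    · rw [Nat.primesBelow_succ, if_pos hn, Finset.prod_insert (Nat.notMem_primesBelow n),
        Finset.prod_insert (Nat.notMem_primesBelow n), norm_mul, norm_mul, mul_mul_mul_comm]
      refine le_mul_of_one_le_left (by positivity) ?_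
      have hn1 : (1 : ℝ) < n := by exact_mod_cast hn.one_lt
      have hx0 : 0 ≤ (n : ℝ) ^ (-σ) := by positivity
      have hx1 : (n : ℝ) ^ (-σ) < 1 := Real.rpow_lt_one_of_one_lt_of_neg hn1 (by linarith)
      set x := (n : ℝ) ^ (-σ)
      have hA : ‖1 - χ (n : ZMod N) * (x : ℂ)‖ ≤ 1 + x := by
        refine (norm_sub_le _ _).trans ?_
        rw [norm_one, norm_mul, Complex.norm_real, Real.norm_eq_abs, abs_of_nonneg hx0]
        have := χ.norm_le_one (n : ZMod N)
        nlinarith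
      have hA0 : 0 < ‖1 - χ (n : ZMod N) * (x : ℂ)‖ := by
        have h4 := norm_sub_norm_le (1 : ℂ) (χ (n : ZMod N) * (x : ℂ))
        rw [norm_one, norm_mul, Complex.norm_real, Real.norm_eq_abs, abs_of_nonneg hx0] at h4
        have := χ.norm_le_one (n : ZMod N)
        nlinarith
      have hB : ‖1 - (x : ℂ)‖ = 1 - x := by
        rw [← Complex.ofReal_one, ← Complex.ofReal_sub, Complex.norm_real, Real.norm_eq_abs,
          abs_of_pos (by linarith)]
      rw [norm_inv, norm_inv, ← mul_inv, hB]
      refine (one_le_inv₀ (mul_pos hA0 (by linarith))).2 ?_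
      nlinarith
    · rw [Nat.primesBelow_succ, if_neg hn]
  have h4 := hmono.ge_of_tendsto h3 (P + 1)
  simp only [one_mul]
  exact h4

/-- The range `σ ≤ 3` contains all `1 + 1 / log P` with `P ≥ 2`. -/
lemma exists_norm_riemannZeta_le :
    ∃ C : ℝ, 0 ≤ C ∧ ∀ σ : ℝ, 1 < σ → σ ≤ 3 → ‖riemannZeta σ‖ ≤ C / (σ - 1) := by
  have hcont : Continuous fun σ : ℝ => DirichletCharacter.LFunctionTrivChar₁ 1 (σ : ℂ) :=
    (DirichletCharacter.differentiable_LFunctionTrivChar₁ 1).continuous.comp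
      Complex.continuous_ofReal
  obtain ⟨C, hC⟩ := (isCompact_Icc (a := (1 : ℝ)) (b := 3)).exists_bound_of_continuousOn
    hcont.continuousOn
  refine ⟨C, (norm_nonneg _).trans (hC 1 (by norm_num)), fun σ h1 h3 => ?_⟩
  have h := hC σ ⟨h1.le, h3⟩
  have hne : (σ : ℂ) ≠ 1 := by exact_mod_cast h1.ne'
  rw [DirichletCharacter.LFunctionTrivChar₁, Function.update_of_ne hne,
    DirichletCharacter.LFunctionTrivChar, DirichletCharacter.LFunction_modOne_eq, norm_mul,
    ← Complex.ofReal_one, ← Complex.ofReal_sub, Complex.norm_real, Real.norm_eq_abs,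
    abs_of_pos (by linarith)] at h
  rw [le_div_iff₀ (by linarith), mul_comm]
  exact h

lemma exists_norm_LSeries_le {N : ℕ} [NeZero N] {χ : DirichletCharacter ℂ N} (hχ : χ ≠ 1) :
    ∃ C : ℝ, 0 ≤ C ∧ ∀ σ : ℝ, 1 < σ → σ ≤ 3 → ‖LSeries (fun n => χ (n : ZMod N)) σ‖ ≤ C := by
  have hcont : Continuous fun σ : ℝ => χ.LFunction (σ : ℂ) :=
    (DirichletCharacter.differentiable_LFunction hχ).continuous.comp Complex.continuous_ofReal
  obtain ⟨C, hC⟩ := (isCompact_Icc (a := (1 : ℝ)) (b := 3)).exists_bound_of_continuousOn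
    hcont.continuousOn
  refine ⟨C, (norm_nonneg _).trans (hC 1 (by norm_num)), fun σ h1 h3 => ?_⟩
  rw [← χ.LFunction_eq_LSeries (by simpa using h1)]
  exact hC σ ⟨h1.le, h3⟩

/-- The quotient of Euler products is `O(1 / log P)`: at `σ = 1 + 1 / log P` the two products are
at most `|L(σ, χ)| ζ(σ) = O(log P)` together, while the one in the denominator is at
least `log P`. -/
lemma exists_norm_eulerProd_div_le {N : ℕ} [NeZero N] {χ : DirichletCharacter ℂ N}
    (hχ : χ ≠ 1) :
    ∃ C : ℝ, 0 ≤ C ∧ ∀ P : ℕ, 2 ≤ P →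
      ‖eulerProd (fun p => χ (p : ZMod N)) P / eulerProd (fun _ => 1) P‖ ≤ C / Real.log P := by
  obtain ⟨A, hA0, hA⟩ := exists_norm_LSeries_le hχ
  obtain ⟨B, hB0, hB⟩ := exists_norm_riemannZeta_le
  refine ⟨Real.exp 6 * Real.exp 6 * (A * B), by positivity, fun P hP => ?_⟩
  have hlogP : Real.log 2 ≤ Real.log P := Real.log_le_log (by norm_num) (by exact_mod_cast hP)
  have hlog2 : 1 / 2 < Real.log 2 := by
    have := Real.log_two_gt_d9
    linarith
  have hlog : 0 < Real.log P := by linarith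
  set σ : ℝ := 1 + 1 / Real.log P with hσ
  have hσ1 : 1 < σ := by
    have : 0 < 1 / Real.log P := by positivity
    linarith
  have hσ3 : σ ≤ 3 := by
    have : 1 / Real.log P ≤ 2 := by
      rw [div_le_iff₀ hlog]
      linarith
    linarith
  have h1 := norm_eulerProd_le (f := fun p => χ (p : ZMod N)) (fun n => χ.norm_le_one _) hP hσ
  have h2 := norm_eulerProd_le (f := fun _ => 1) (fun n => by simp) hP hσ
  have h3 := norm_prod_mul_norm_prod_le χ hσ1 P
  have h4 := hB σ hσ1 hσ3
  rw [hσ, add_sub_cancel_left, ← hσ, div_div_eq_mul_div, div_one] at h4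
  have h5 := mul_le_mul (hA σ hσ1 hσ3) h4 (norm_nonneg _) hA0
  have h6 := mul_le_mul h1 h2 (norm_nonneg _) (by positivity)
  have hE := log_le_norm_eulerProd_one (P := P) (by lia)
  set X := ‖eulerProd (fun p => χ (p : ZMod N)) P‖
  set E := ‖eulerProd (fun _ => 1) P‖
  have h7 : X * E ≤ Real.exp 6 * Real.exp 6 * (A * B) * Real.log P := by
    rw [mul_mul_mul_comm] at h6
    refine h6.trans ?_
    rw [mul_assoc (Real.exp 6 * Real.exp 6)]
    refine mul_le_mul_of_nonneg_left ?_ (by positivity)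
    linarith
  have hE0 : 0 < E := hlog.trans_le hE
  rw [norm_div, div_le_div_iff₀ hE0 hlog]
  have hX : 0 ≤ X := norm_nonneg _
  have h8 : (X * Real.log P) * Real.log P ≤ (Real.exp 6 * Real.exp 6 * (A * B) * E) *
      Real.log P :=
    calc (X * Real.log P) * Real.log P ≤ (X * E) * Real.log P := by gcongr
      _ ≤ (Real.exp 6 * Real.exp 6 * (A * B) * Real.log P) * Real.log P := by gcongr
      _ ≤ (Real.exp 6 * Real.exp 6 * (A * B) * E) * Real.log P := by gcongr
  exact le_of_mul_le_mul_right h8 hlog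

/-! ### Bounds for the summands -/

/-- Only the prime `2` has `p - 1 < 2`, which costs the factor `2`. -/
lemma prod_two_le_prod_sub_one (s : Finset ℕ) (hs : ∀ p ∈ s, p.Prime) :
    ∏ _p ∈ s, 2 ≤ 2 * ∏ p ∈ s, (p - 1) := by
  have h : ∀ t : Finset ℕ, (∀ p ∈ t, 3 ≤ p) → ∏ _p ∈ t, 2 ≤ ∏ p ∈ t, (p - 1) := fun t ht =>
    Finset.prod_le_prod' fun p hp => by have := ht p hp; lia
  have h3 : ∀ p ∈ s.erase 2, 3 ≤ p := by
    intro p hp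
    rw [Finset.mem_erase] at hp
    have := (hs p hp.2).two_le
    lia
  have h4 := h (s.erase 2) h3
  by_cases h2 : 2 ∈ s
  · rw [← Finset.mul_prod_erase s (fun _ => 2) h2, ← Finset.mul_prod_erase s (fun p => p - 1) h2]
    lia
  · rw [Finset.erase_eq_of_notMem h2] at h4
    lia

lemma prod_two_primeFactors_le {n : ℕ} (hn : n ≠ 0) :
    ∏ _p ∈ n.primeFactors, 2 ≤ 2 * Nat.totient n := by
  refine (prod_two_le_prod_sub_one _ fun p hp => Nat.prime_of_mem_primeFactors hp).trans ?_
  refine Nat.mul_le_mul_left 2 ?_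
  rw [Nat.totient_eq_div_primeFactors_mul]
  refine Nat.le_mul_of_pos_left _ (Nat.div_pos ?_ ?_)
  · exact Nat.le_of_dvd (Nat.pos_of_ne_zero hn) (Nat.prod_primeFactors_dvd n)
  · exact Finset.prod_pos fun p hp => (Nat.prime_of_mem_primeFactors hp).pos

lemma norm_tau_le {n : ℕ} [NeZero n] (χ : DirichletCharacter ℂ n) : ‖tau χ‖ ≤ n := by
  rw [tau, gaussSum]
  refine (norm_sum_le_of_le _ (n := fun _ => (1 : ℝ)) fun a _ => ?_).trans ?_
  · rw [norm_mul, AddChar.norm_apply, mul_one]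
    exact χ.norm_le_one a
  · simp

/-- The dependence on `ℓ` is harmless since `2 ^ ω(ℓ'') ≤ 2 φ(ℓ'') ≤ 2 φ(ℓ')`. -/
lemma norm_charTerm_le {n : ℕ} [NeZero n] (χ : DirichletCharacter ℂ n) (j : ℤ) (P : ℕ) {m : ℕ}
    (hm : m ≠ 0) :
    ‖charTerm χ j P m‖ ≤ n * 2 *
      ‖eulerProd (fun p => χ (p : ZMod n)) P / eulerProd (fun _ => 1) P‖ := by
  have hdvd : m / m.gcd n ∣ m := Nat.div_dvd_of_dvd (Nat.gcd_dvd_left m n)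
  have hk0 : m / m.gcd n ≠ 0 := fun h => hm (Nat.eq_zero_of_zero_dvd (h ▸ hdvd))
  have hφ : (0 : ℝ) < Nat.totient m := by
    exact_mod_cast Nat.totient_pos.2 (Nat.pos_of_ne_zero hm)
  have hprod : ‖∏ p ∈ (m / m.gcd n).primeFactors, (1 - (star χ) (p : ZMod n))‖
      ≤ 2 * Nat.totient m := by
    calc ‖∏ p ∈ (m / m.gcd n).primeFactors, (1 - (star χ) (p : ZMod n))‖
        ≤ ∏ _p ∈ (m / m.gcd n).primeFactors, (2 : ℝ) := by
          rw [norm_prod]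
          refine Finset.prod_le_prod (fun _ _ => norm_nonneg _) fun p _ => ?_
          refine (norm_sub_le _ _).trans ?_
          have := DirichletCharacter.norm_le_one (star χ) (p : ZMod n)
          rw [norm_one]
          linarith
      _ ≤ 2 * Nat.totient (m / m.gcd n) := by exact_mod_cast prod_two_primeFactors_le hk0
      _ ≤ 2 * Nat.totient m := by
          gcongr
          exact Nat.le_of_dvd (by exact_mod_cast hφ) (Nat.totient_dvd_of_dvd hdvd)
  have hmu : ‖((μ (m.gcd n) : ℤ) : ℂ)‖ ≤ 1 := by
    rw [Complex.norm_intCast]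
    exact_mod_cast ArithmeticFunction.abs_moebius_le_one
  unfold charTerm
  simp only [norm_mul, norm_div, Complex.norm_natCast]
  have h1 : ‖((μ (m.gcd n) : ℤ) : ℂ)‖ * ‖χ ((m / m.gcd n : ℕ) : ZMod n)‖ ≤ 1 :=
    mul_le_one₀ hmu (norm_nonneg _) (χ.norm_le_one _)
  have h2 : ‖tau (star χ)‖ * ‖χ (j : ZMod n)‖ ≤ n := by
    have := mul_le_mul (norm_tau_le (star χ)) (χ.norm_le_one (j : ZMod n)) (norm_nonneg _)
      (Nat.cast_nonneg n)
    rwa [mul_one] at this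
  have h3 : ‖((μ (m.gcd n) : ℤ) : ℂ)‖ * ‖χ ((m / m.gcd n : ℕ) : ZMod n)‖ / Nat.totient m *
      ‖∏ p ∈ (m / m.gcd n).primeFactors, (1 - (star χ) (p : ZMod n))‖ ≤ 2 := by
    rw [div_mul_eq_mul_div, div_le_iff₀ hφ]
    have := mul_le_mul h1 hprod (norm_nonneg _) zero_le_one
    linarith
  refine mul_le_mul_of_nonneg_right ?_ (by positivity)
  rw [mul_assoc]
  exact mul_le_mul h2 h3 (by positivity) (Nat.cast_nonneg n)

lemma exists_norm_charTerm_le {n : ℕ} [NeZero n] {χ : DirichletCharacter ℂ n} (hχ : χ ≠ 1) :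
    ∃ C : ℝ, 0 ≤ C ∧ ∀ (j : ℤ) (P m : ℕ), 2 ≤ P → m ≠ 0 →
      ‖charTerm χ j P m‖ ≤ C / Real.log P := by
  obtain ⟨C, hC0, hC⟩ := exists_norm_eulerProd_div_le hχ
  refine ⟨n * 2 * C, by positivity, fun j P m hP hm => ?_⟩
  refine (norm_charTerm_le χ j P hm).trans ?_
  rw [mul_div_assoc]
  exact mul_le_mul_of_nonneg_left (hC P hP) (by positivity)

lemma exists_norm_formulaSum_le (q : ℕ) [NeZero q] :
    ∃ C : ℝ, 0 ≤ C ∧ ∀ (j : ℤ) (P ℓ : ℕ), 2 ≤ P → ℓ ≠ 0 →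
      ‖formulaSum q j P ℓ‖ ≤ C / Real.log P := by
  have h : ∀ (b : q.divisors) (χ : DirichletCharacter ℂ (q / (b : ℕ))), ∃ C : ℝ, 0 ≤ C ∧
      (χ ≠ 1 → ∀ (j : ℤ) (P m : ℕ), 2 ≤ P → m ≠ 0 → ‖charTerm χ j P m‖ ≤ C / Real.log P) := by
    intro b χ
    by_cases hχ : χ = 1
    · exact ⟨0, le_rfl, fun h => absurd hχ h⟩
    · obtain ⟨C, hC0, hC⟩ := exists_norm_charTerm_le hχ
      exact ⟨C, hC0, fun _ => hC⟩
  choose C hC0 hC using h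
  refine ⟨∑ b : q.divisors, ‖1 / (((b : ℕ) : ℂ) * (Nat.totient (q / (b : ℕ)) : ℂ))‖ *
    ∑ χ : DirichletCharacter ℂ (q / (b : ℕ)) with χ ≠ 1, C b χ,
    Finset.sum_nonneg fun b _ => mul_nonneg (norm_nonneg _)
      (Finset.sum_nonneg fun χ _ => hC0 b χ), fun j P ℓ hP hℓ => ?_⟩
  rw [formulaSum, Finset.sum_div]
  refine norm_sum_le_of_le _ fun b _ => ?_
  rw [norm_mul, mul_div_assoc, Finset.sum_div]
  refine mul_le_mul_of_nonneg_left (norm_sum_le_of_le _ fun χ hχ => ?_) (norm_nonneg _)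
  refine hC b χ (Finset.mem_filter.1 hχ).2 j P _ hP ?_
  exact (Nat.div_pos (Nat.le_of_dvd (Nat.pos_of_ne_zero hℓ) (Nat.gcd_dvd_left ℓ b))
    (Nat.gcd_pos_of_pos_left _ (Nat.pos_of_ne_zero hℓ))).ne'

end CarmichaelSmooth

theorem theorem5 (q : ℕ) [NeZero q] :
    -- the coefficients exist, and the explicit formula
    (∀ j : ℤ, IsCoprime j (q : ℤ) → ∀ P : ℕ, P.Prime → q ≤ P →
      (∀ ℓ : ℕ, 1 ≤ ℓ →
        CarmichaelExists (expFun q j) ℓ ∧ SmoothCarmichaelExists P (expFun q j) ℓ) ∧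
      (∀ ℓ : ℕ, ℓ ∈ Nat.smoothNumbers (P + 1) →
        smoothCar P (expFun q j) ℓ = car (expFun q j) ℓ +
          ∑ b : q.divisors,
            1 / (((b : ℕ) : ℂ) * (Nat.totient (q / (b : ℕ)) : ℂ)) *
              ∑ χ : DirichletCharacter ℂ (q / (b : ℕ)) with χ ≠ 1,
                charTerm χ j P (ℓ / Nat.gcd ℓ (b : ℕ)))) ∧
    -- the bound, with a constant depending only on `q`
    (∃ C : ℝ, ∀ j : ℤ, IsCoprime j (q : ℤ) → ∀ P : ℕ, P.Prime → q ≤ P → ∀ ℓ : ℕ, 1 ≤ ℓ →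
      ‖smoothCar P (expFun q j) ℓ - car (expFun q j) ℓ‖ ≤ C / Real.log P ∧
      ‖smoothCar P (expFun q j) ℓ - (if ℓ = q then 1 / (Nat.totient q : ℂ) else 0)‖
        ≤ C / Real.log P) := by
  refine ⟨fun j hj P _ hqP => ⟨fun ℓ hℓ => ?_, fun ℓ hℓ => ?_⟩, ?_⟩
  · have hℓ0 : ℓ ≠ 0 := by lia
    refine ⟨carmichaelExists_of_hasMean (hasMean_expFun_mul_ramanujanSum hℓ0 hj), ?_⟩
    by_cases hmem : ℓ ∈ Nat.smoothNumbers (P + 1)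
    · exact carmichaelExists_of_hasMean (hasMean_smoothRestriction_of_mem hj hqP hmem)
    · exact carmichaelExists_of_hasMean (hasMean_smoothRestriction_of_notMem hℓ0 hmem)
  · exact smoothCar_expFun_of_mem hj hqP hℓ
  · obtain ⟨C, hC0, hC⟩ := exists_norm_formulaSum_le q
    refine ⟨C, fun j hj P hP hqP ℓ hℓ => ?_⟩
    have hℓ0 : ℓ ≠ 0 := by lia
    rw [← car_expFun hℓ0 hj, and_self]
    by_cases hmem : ℓ ∈ Nat.smoothNumbers (P + 1)
    · rw [smoothCar_expFun_of_mem hj hqP hmem, add_sub_cancel_left]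
      exact hC j P ℓ hP.two_le hℓ0
    · -- Here `ℓ > P ≥ q`, and both coefficients vanish.
      have hℓq : ℓ ≠ q := by
        rintro rfl
        exact hmem (Nat.mem_smoothNumbers_of_lt hℓ (by lia))
      rw [smoothCar_expFun_of_notMem hℓ0 hmem, car_expFun hℓ0 hj, if_neg hℓq, sub_zero, norm_zero]
      exact div_nonneg hC0 (Real.log_natCast_nonneg P)
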